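/- **Construction.** Let $\mathcal A=(a_i)_{i\ge 1}$ be a sequence of real numbers $a_i>2$. Put $t_n=\prod_{i=1}^n a_i^{-1}$ and $w_n=t_{n-1}(1-\tfrac{2}{a_n})=t_{n-1}-2t_n$. The island on day $0$ is $I_0=(0,1)^2$. On day $n\ge 1$ one digs from the island $I_{n-1}$ (a strip of width $t_{n-1}$) the closed canal $C_n$ consisting of all points of $I_{n-1}$ whose distance in the maximum norm to the complement of $I_{n-1}$ is at least $t_n$ (a canal of width $w_n$ along the middle of the strip, leaving a strip of width $t_n$ on every side) and of a mouth, and one puts $I_n=I_{n-1}\setminus C_n$. The mouth is a closed rectangle of length $t_n$ and width $\mu_n$ that starts at a point $p_n$, the middle of one of its two sides of length $\mu_n$, where $\mu_n=w_n$ for $n\le 3$ and $\mu_n=\min(w_n,w_{n-3})$ for $n\ge 4$. The starting points are as follows. - Days 1, 2, 3: $p_n$ lies on the left side of the square and the mouth goes to the right. $p_1=(0,\tfrac12)$ and $p_2=(0,\tfrac{t_1}{2})$, and $p_3=(0,\tfrac{t_1}{2}\pm\tfrac{w_2+t_2}{2})$ is the middle of one of the two ends (freely chosen) of the strip $I_2$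 on the left side, below and above the mouth of $C_2$. - Day $n\ge 4$: $p_n$ is a peak point of $C_{n-3}$, i.e. the middle of an end face of $C_{n-3}$, and the mouth continues that canal straight ahead. The canal $C_1$ has the single peak point $(1-t_1,\tfrac12)$; $C_2$ has the single peak point $(t_2,1-\tfrac{t_1}{2})$; $C_3$ has a single peak point, at distance $t_3$ from the end of $I_2$ that was not chosen for $p_3$. For $m\ge 3$ the strip $I_m$ has two ends, one on each side of the mouth of $C_m$ (for $m=3$ they lie on the left side of the square), and $C_{m+1}$ has two peak points, one at distance $t_{m+1}$ from each of these ends; $p_{m+4}$ is one of the two, freely chosen. Let $B_{3k+1}$, $R_{3k+2}$, $G_{3k+3}$ be the interiors of $\bigcup_{j\le k}C_{3j+1}$, $\bigcup_{j\le k}C_{3j+2}$, $\bigcup_{j\le k}C_{3j+3}$, and let $U_B=\bigcup_k B_{3k+1}$, $U_R=\bigcup_k R_{3k+2}$, $U_G=\bigcup_k G_{3k+3}$ be the three lakes. For a bounded set $S\subset\mathbb R^2$ let $N(\varepsilon)$ be the least number of closed axis-parallel squares of side $\varepsilon$ that cover $S$, and let $\dim_{\sf box}(S)=\lim_{\varepsilon\to0+}\ln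 N(\varepsilon)/\ln(1/\varepsilon)$ if this limit exists. **Theorem.** For every sequence $\mathcal A=(a_i)_{i\ge1}$ with all $a_i>2$ and all choices in the construction, the three lakes have the same boundary in the open unit square, $$W_{\mathcal A}:=(0,1)^2\cap\partial U_B=(0,1)^2\cap\partial U_R=(0,1)^2\cap\partial U_G ,$$ and $$\dim_{\sf box}(W_{\mathcal A})=1+\lim_{n\to\infty}\frac{n\ln 2}{\sum_{i=1}^n\ln a_i},$$ in the sense that the dimension on the left exists if and only if the limit on the right exists, and then the two sides are equal. In particular, for a constant sequence $c,c,c,\dots$ with $c>2$ the dimension of the common boundary $W_c$ exists and $$\dim_{\sf box}(W_c)=\frac{\ln(2c)}{\ln c},$$ and this value tends to $1$ as $c\to+\infty$. -/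

import Mathlib

namespace Wada

/-! ### Box-counting dimension of a plane set

The plane is `ℝ × ℝ` with the maximum metric, so that a closed ball of radius `ε / 2` is exactly a
closed axis-parallel square of side `ε`. -/

/-- The least number of closed squares of side `ε` that cover `S`. -/
noncomputable def boxCount (ε : ℝ) (S : Set (ℝ × ℝ)) : ℕ :=
  (Metric.externalCoveringNumber (Real.toNNReal (ε / 2)) S).toNat

/-- The Minkowski (box-counting) dimension of `S` exists and is equal to `d`. -/
def HasBoxDim (S : Set (ℝ × ℝ)) (d : ℝ) : Prop :=
  Filter.Tendsto (fun ε : ℝ => Real.log (boxCount ε S) / Real.log (1 / ε))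
    (nhdsWithin 0 (Set.Ioi 0)) (nhds d)

/-! ### The lakes

The scaling sequence is `a 1, a 2, …`; the value `a 0` is never used. The choices left open by the
construction (which of two ends of the island, or of two peak points, is used on a given day) are
recorded by an arbitrary `σ : ℕ → Bool`. -/

/-- `t n = 1 / (a 1 ⋯ a n)`, the width of the strip that the island is after day `n`. -/
noncomputable def t (a : ℕ → ℝ) (n : ℕ) : ℝ := ∏ i ∈ Finset.Icc 1 n, (a i)⁻¹

/-- The width of the canal of day `n ≥ 1`; it is equal to `t (n - 1) - 2 * t n`. -/
noncomputable def w (a : ℕ → ℝ) (n : ℕ) : ℝ :=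
  (∏ i ∈ Finset.Icc 1 (n - 1), (a i)⁻¹) * (1 - 2 / a n)

/-- The sign of the choice made on day `n`. -/
def sgn (σ : ℕ → Bool) (n : ℕ) : ℝ := if σ n then 1 else -1

/-- The width of the mouth of the canal of day `n`. On days 1 to 3 the canal starts at the left
side of the square, at full width. Later it starts at the end face of the canal of day `n - 3`, a
segment of length `w (n - 3)`: the canal leaves the old lake through that face. (If
`w n ≤ w (n - 3)`, for instance if every `a i ≥ 9 / 4` or if `a` is constant, the mouth has the
full width `w n`.) -/
noncomputable def mouthWidth (a : ℕ → ℝ) (n : ℕ) : ℝ :=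
  if n ≤ 3 then w a n else min (w a n) (w a (n - 3))

/-- `gate a σ n = (p, u)`: the canal of day `n` starts at the point `p` in the unit direction `u`.

* Day 1: the middle of the left side of the unit square, to the right.
* Day 2: the island is a strip with both ends on the left side, below and above the first canal.
  The canal enters at the lower end and stops at distance `t 2` from the upper end.
* Day 3: the island is a strip whose ends lie on the left side, below and above the mouth of the
  second canal. The canal enters at one of them and stops at distance `t 3` from the other.
* Days 4, 5, 6: the canal starts at the peak point (the middle of the end face) of the canal of
  day 1, 2, 3.
* Day 7: the canal of day 4 has two peak points, at distance `t 4` from the two ends of the island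
  of day 3, which lie on the left side, below and above the mouth of the third canal; the canal
  starts at one of them.
* Day `m + 4` with `m ≥ 4`: the two ends of the island of day `m` lie on both sides of the mouth of
  the canal of day `m`. The canal of day `m + 1` has a peak point at distance `t (m + 1)` from each
  of them; the canal of day `m + 4` starts at one of these two peak points, towards that mouth. -/
noncomputable def gate (a : ℕ → ℝ) (σ : ℕ → Bool) : ℕ → (ℝ × ℝ) × (ℝ × ℝ)
  | 0 => ((0, 1 / 2), (1, 0))
  | 1 => ((0, 1 / 2), (1, 0))
  | 2 => ((0, t a 1 / 2), (1, 0))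
  | 3 => ((0, t a 1 / 2 + sgn σ 3 * (w a 2 / 2 + t a 2 / 2)), (1, 0))
  | 4 => ((1 - t a 1, 1 / 2), (1, 0))
  | 5 => ((t a 2, 1 - t a 1 / 2), (-1, 0))
  | 6 => ((t a 3, t a 1 / 2 - sgn σ 3 * (w a 2 / 2 + t a 2 / 2)), (-1, 0))
  | 7 => ((t a 4, t a 1 / 2 + sgn σ 3 * (w a 2 / 2 + t a 2 / 2)
            + sgn σ 7 * (w a 3 / 2 + t a 3 / 2)), (-1, 0))
  | n + 8 =>
    let m := n + 4
    let p := (gate a σ m).1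
    let u := (gate a σ m).2
    let v : ℝ × ℝ := (-u.2, u.1)
    (p + (t a m / 2) • u + (sgn σ (n + 8) * (mouthWidth a m / 2 + t a (m + 1))) • v,
      (-sgn σ (n + 8)) • v)

/-- The mouth of the canal of day `n`: the rectangle of length `t n` that joins the starting point
to the middle of the strip. -/
noncomputable def mouth (a : ℕ → ℝ) (σ : ℕ → Bool) (n : ℕ) : Set (ℝ × ℝ) :=
  {x | ∃ s r : ℝ, 0 ≤ s ∧ s ≤ t a n ∧ |r| ≤ mouthWidth a n / 2 ∧
    x = (gate a σ n).1 + s • (gate a σ n).2 + r • (-(gate a σ n).2.2, (gate a σ n).2.1)}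

/-- What is dug on day `n` from the island `I`: all points of `I` whose distance, in the maximum
norm, to the complement of `I` is at least `t n`, together with the mouth. As `I` is a strip of
width `t (n - 1)`, this is a canal of width `w n` along the middle of the strip, leaving a strip of
width `t n` along each side and at the ends. -/
noncomputable def dig (a : ℕ → ℝ) (σ : ℕ → Bool) (n : ℕ) (I : Set (ℝ × ℝ)) : Set (ℝ × ℝ) :=
  {x | Metric.ball x (t a n) ⊆ I} ∪ mouth a σ n

/-- The open unit square. -/
def unitSquare : Set (ℝ × ℝ) := Set.Ioo 0 1 ×ˢ Set.Ioo 0 1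

/-- The island after day `n`. -/
noncomputable def island (a : ℕ → ℝ) (σ : ℕ → Bool) : ℕ → Set (ℝ × ℝ)
  | 0 => unitSquare
  | n + 1 => island a σ n \ dig a σ (n + 1) (island a σ n)

/-- The (closed) canal dug on day `n ≥ 1`. -/
noncomputable def canal (a : ℕ → ℝ) (σ : ℕ → Bool) (n : ℕ) : Set (ℝ × ℝ) :=
  dig a σ n (island a σ (n - 1))

/-- The open lake which on day `3 * k + c` consists of the canals of days `c, 3 + c, …, 3 * k + c`;
`c = 1, 2, 3` is the blue, the red and the green lake. -/
noncomputable def lakeOnDay (a : ℕ → ℝ) (σ : ℕ → Bool) (c k : ℕ) : Set (ℝ × ℝ) :=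
  interior (⋃ j ∈ Finset.range (k + 1), canal a σ (3 * j + c))

/-- The final lake of colour `c`. -/
noncomputable def lake (a : ℕ → ℝ) (σ : ℕ → Bool) (c : ℕ) : Set (ℝ × ℝ) :=
  ⋃ k : ℕ, lakeOnDay a σ c k

/-- The boundary of the blue lake in the open unit square. -/
noncomputable def W (a : ℕ → ℝ) (σ : ℕ → Bool) : Set (ℝ × ℝ) :=
  unitSquare ∩ frontier (lake a σ 1)

end Wada

/-! Let the depth of a point be its max-norm distance to the complement of the island. Only metric
facts about the islands are needed, never the shape of the winding strip: depth grows at unit speed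
from any point up to t_n/2, and the points of depth greater than s have total area (t_n - 2s)(l_n -
2s), as in a t_n by l_n rectangle. `IsStrip.dug` shows that digging preserves this, with l_(n+1) = 2
l_n + 2(t_n - 2 t_(n+1)) minus the mouth width, so l_n lies between 2^n and 3·2^n. Its hypothesis is
that the mouth opens into an undisturbed rectangle of the island; `goodGate` proves this by
induction from the four preceding days.

Topology: apart from the left side of the square, a mouth touches older canals only along the end
face of the canal of three days before, so canals of different colours are disjoint in the square
(`mod_three_eq_of_mem_canal`). Hence the points of the square in no lake, the `shore`, lie in the
closure of every island; and every point of the n-th island is within t_n/2 of the next canal, whose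
colour runs through all three. So the shore is the boundary of each lake (`inter_frontier_lake`).
Conversely, a short segment between two different lakes is connected and must cross the shore, so
every point of the n-th island is within 3 t_n of it (`exists_mem_shore_dist_le`).

Dimension: for t_(n+1)/2 ≤ ε < t_n/2 the shore looks, at scale ε, like a collar of width about ε
along the rim of the n-th island. Comparing areas gives N(ε) between constant multiples of 2^n/ε
(`boxCount_shore_mem_Icc`). With S_n the sum of ln a_i for i ≤ n, ln(1/ε) lies between S_n and
S_(n+1) + ln 2, so ln N(ε)/ln(1/ε) - 1 is bracketed, up to O(1/ln(1/ε)), by the terms n+1 and n of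
the sequence n ln 2 / S_n. This works even for unbounded a_i. The scales ε = t_(n+1)/2 give the
converse. -/

namespace Wada

open Metric Set MeasureTheory

/-! ### The depth of a point in a set -/

section Depth

variable {X : Type*} [PseudoMetricSpace X] {I : Set X} {x y z : X}

/-- The distance of `x` to the complement of `I`. -/
noncomputable def depth (I : Set X) (x : X) : ℝ := infDist x Iᶜ

lemma depth_nonneg : 0 ≤ depth I x := infDist_nonneg

lemma depth_le_dist (hz : z ∉ I) : depth I x ≤ dist x z := infDist_le_dist_of_mem hz

lemma depth_le_depth_add_dist : depth I x ≤ depth I y + dist x y := infDist_le_infDist_add_dist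

lemma continuous_depth : Continuous (depth I) := continuous_infDist_pt _

lemma le_depth_iff (hI : Iᶜ.Nonempty) {ρ : ℝ} : ρ ≤ depth I x ↔ ball x ρ ⊆ I := by
  constructor
  · intro h
    exact (ball_subset_ball h).trans ball_infDist_compl_subset
  · intro h
    by_contra! hlt
    obtain ⟨y, hy, hxy⟩ := (infDist_lt_iff hI).1 hlt
    exact hy (h (by rwa [mem_ball, dist_comm]))

lemma depth_pos_iff (hI : Iᶜ.Nonempty) (ho : IsOpen I) : 0 < depth I x ↔ x ∈ I := by
  rw [depth, ← ho.isClosed_compl.notMem_iff_infDist_pos hI, notMem_compl_iff]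

lemma depth_mono {J : Set X} (hI : Iᶜ.Nonempty) (h : J ⊆ I) : depth J x ≤ depth I x :=
  infDist_le_infDist_of_subset (compl_subset_compl.2 h) hI

lemma exists_dist_eq_depth [ProperSpace X] (hI : Iᶜ.Nonempty) (ho : IsOpen I) (x : X) :
    ∃ z ∉ I, dist x z = depth I x := by
  obtain ⟨z, hz, h⟩ := ho.isClosed_compl.exists_infDist_eq_dist hI x
  exact ⟨z, hz, h.symm⟩

end Depth

lemma exists_dist_eq_of_le_dist {E : Type*} [NormedAddCommGroup E] [NormedSpace ℝ E] (x y : E)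
    {δ : ℝ} (h0 : 0 ≤ δ) (h : δ ≤ dist x y) :
    ∃ z, dist x z = δ ∧ dist z y = dist x y - δ := by
  rcases h0.eq_or_lt with rfl | hδ
  · exact ⟨x, by simp⟩
  have hd : 0 < dist x y := hδ.trans_le h
  refine ⟨AffineMap.lineMap x y (δ / dist x y), ?_, ?_⟩
  · rw [dist_left_lineMap, Real.norm_of_nonneg (by positivity)]
    field_simp
  · rw [dist_lineMap_right, Real.norm_of_nonneg (by rw [sub_nonneg, div_le_one hd]; exact h)]
    field_simp

/-- The points of smaller depth on the way to a nearest point of the complement. -/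
lemma exists_depth_eq_of_le_depth {E : Type*} [NormedAddCommGroup E] [NormedSpace ℝ E]
    [ProperSpace E] {I : Set E} (hI : Iᶜ.Nonempty) (ho : IsOpen I) {x : E} {τ : ℝ} (h0 : 0 ≤ τ)
    (h : τ ≤ depth I x) : ∃ y, dist x y = depth I x - τ ∧ depth I y = τ := by
  obtain ⟨z, hz, hxz⟩ := exists_dist_eq_depth hI ho x
  obtain ⟨y, h1, h2⟩ := exists_dist_eq_of_le_dist x z (δ := depth I x - τ) (by linarith)
    (by linarith)
  refine ⟨y, h1, le_antisymm ?_ ?_⟩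
  · have := depth_le_dist (x := y) hz
    linarith
  · have := depth_le_depth_add_dist (I := I) (x := x) (y := y)
    linarith

/-! ### Strips -/

/-- A set that resembles a strip of width `t` and length `l` as far as the depths of its points are
concerned. -/
structure IsStrip (I : Set (ℝ × ℝ)) (t l : ℝ) : Prop where
  isOpen : IsOpen I
  nonempty_compl : Iᶜ.Nonempty
  exists_le_depth : ∀ x ∈ I, ∃ y, dist x y ≤ t / 2 - depth I x ∧ t / 2 ≤ depth I y
  volume_lt_depth : ∀ s, 0 ≤ s → s < t / 2 →
    volume {x | s < depth I x} = ENNReal.ofReal ((t - 2 * s) * (l - 2 * s))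

namespace IsStrip

variable {I : Set (ℝ × ℝ)} {t l : ℝ}

lemma depth_le (h : IsStrip I t l) (ht : 0 < t) (x : ℝ × ℝ) : depth I x ≤ t / 2 := by
  by_cases hx : x ∈ I
  · obtain ⟨y, hy, -⟩ := h.exists_le_depth x hx
    have := dist_nonneg (x := x) (y := y)
    linarith
  · have := depth_le_dist (x := x) hx
    rw [dist_self] at this
    linarith

/-- Depth is 1-Lipschitz and rises to t/2 within distance t/2 - depth, so along the segment to the
core it grows at exactly unit speed. -/
lemma exists_depth_eq (h : IsStrip I t l) {x : ℝ × ℝ} (hx : x ∈ I) {τ : ℝ} (h1 : depth I x ≤ τ)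
    (h2 : τ ≤ t / 2) : ∃ y, dist x y ≤ τ - depth I x ∧ depth I y = τ := by
  obtain ⟨z, hz, hz'⟩ := h.exists_le_depth x hx
  have hzx := depth_le_depth_add_dist (I := I) (x := z) (y := x)
  rw [dist_comm] at hzx
  obtain ⟨y, hy1, hy2⟩ := exists_dist_eq_of_le_dist x z (δ := τ - depth I x) (by linarith)
    (by linarith)
  refine ⟨y, hy1.le, le_antisymm ?_ ?_⟩
  · have := depth_le_depth_add_dist (I := I) (x := y) (y := x)
    rw [dist_comm] at this
    linarith
  · have := depth_le_depth_add_dist (I := I) (x := z) (y := y)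
    rw [dist_comm] at this
    linarith

/-- The closed superlevel set lies in the open ones for all r < s, and the area formula is
continuous in r. -/
lemma volume_le_depth (h : IsStrip I t l) {s : ℝ} (h0 : 0 < s) (hs : s < t / 2) :
    volume {x | s ≤ depth I x} = ENNReal.ofReal ((t - 2 * s) * (l - 2 * s)) := by
  refine le_antisymm ?_ ?_
  · have hc : Filter.Tendsto (fun r : ℝ => ENNReal.ofReal ((t - 2 * r) * (l - 2 * r)))
        (nhdsWithin s (Iio s)) (nhds (ENNReal.ofReal ((t - 2 * s) * (l - 2 * s)))) := by
      apply Filter.Tendsto.mono_left _ nhdsWithin_le_nhds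
      exact (ENNReal.continuous_ofReal.comp (by fun_prop)).tendsto s
    refine ge_of_tendsto hc ?_
    filter_upwards [Ioo_mem_nhdsLT h0] with r hr
    rw [← h.volume_lt_depth r hr.1.le (hr.2.trans hs)]
    exact measure_mono fun x (hx : s ≤ depth I x) => hr.2.trans_le hx
  · rw [← h.volume_lt_depth s h0.le hs]
    exact measure_mono fun x (hx : s < depth I x) => le_of_lt hx

end IsStrip

/-! ### Gates -/

lemma prod_dist_lt {a b : ℝ × ℝ} {δ : ℝ} :
    dist a b < δ ↔ |a.1 - b.1| < δ ∧ |a.2 - b.2| < δ := by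
  rw [Prod.dist_eq, max_lt_iff, Real.dist_eq, Real.dist_eq]

lemma prod_dist_le {a b : ℝ × ℝ} {δ : ℝ} :
    dist a b ≤ δ ↔ |a.1 - b.1| ≤ δ ∧ |a.2 - b.2| ≤ δ := by
  rw [Prod.dist_eq, max_le_iff, Real.dist_eq, Real.dist_eq]

/-- In the coordinates given by `φ`, a rectangle of length `T` and width `m + 2 * t` belongs to `I`,
while the middle part of length `m` of one of its sides does not meet `I`. -/
structure IsGate (I : Set (ℝ × ℝ)) (T t m : ℝ) (φ : ℝ × ℝ → ℝ × ℝ) : Prop where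
  mem : ∀ s r, 0 < s → s < T → |r| < m / 2 + t → φ (s, r) ∈ I
  notMem : ∀ r, |r| ≤ m / 2 → φ (0, r) ∉ I

/-- The rectangle of length `t` and width `m` in the coordinates given by `φ`. -/
def mouthRect (t m : ℝ) (φ : ℝ × ℝ → ℝ × ℝ) : Set (ℝ × ℝ) :=
  φ '' (Icc 0 t ×ˢ Icc (-(m / 2)) (m / 2))

lemma exists_clip {m : ℝ} (hm : 0 ≤ m) (r : ℝ) :
    ∃ r', |r'| ≤ m / 2 ∧ |r - r'| ≤ max 0 (|r| - m / 2) := by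
  rcases le_total |r| (m / 2) with h | h
  · exact ⟨r, h, by simp⟩
  · rcases abs_cases r with ⟨h1, h2⟩ | ⟨h1, h2⟩
    · refine ⟨m / 2, by rw [abs_of_nonneg (by linarith)], ?_⟩
      rw [abs_of_nonneg (by linarith), h1]
      exact le_max_right _ _
    · refine ⟨-(m / 2), by rw [abs_neg, abs_of_nonneg (by linarith)], ?_⟩
      rw [abs_of_nonpos (by linarith), h1]
      exact (by linarith : -(r - -(m/2)) = -r - m/2) ▸ le_max_right _ _

namespace IsGate

variable {I : Set (ℝ × ℝ)} {T t m : ℝ} {φ : (ℝ × ℝ) ≃ᵢ (ℝ × ℝ)}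

/-- The hypotheses say that the square of radius ρ fits into the free rectangle. With the upper
bound `IsGate.depth_le`, this pins down the depth near the gate. -/
lemma le_depth (h : IsGate I T t m φ) {s r ρ : ℝ} (h1 : ρ ≤ s) (h2 : s + ρ ≤ T)
    (h3 : |r| + ρ ≤ m / 2 + t) (hm : 0 ≤ m) : ρ ≤ depth I (φ (s, r)) := by
  refine (le_depth_iff ⟨φ (0, 0), h.notMem 0 (by simpa using by linarith)⟩).2 fun y hy => ?_
  obtain ⟨⟨s', r'⟩, rfl⟩ := φ.surjective y
  rw [mem_ball, φ.dist_eq, prod_dist_lt, abs_lt] at hy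
  obtain ⟨⟨h4, h5⟩, h6⟩ := hy
  have := abs_sub_abs_le_abs_sub r' r
  dsimp only at *
  exact h.mem _ _ (by linarith) (by linarith) (by linarith)

lemma depth_le (h : IsGate I T t m φ) (hm : 0 ≤ m) (s r : ℝ) :
    depth I (φ (s, r)) ≤ max |s| (|r| - m / 2) := by
  obtain ⟨r', h1, h2⟩ := exists_clip hm r
  refine (depth_le_dist (h.notMem r' h1)).trans ?_
  rw [φ.dist_eq, prod_dist_le]
  refine ⟨by simp, h2.trans (max_le_max (abs_nonneg _) le_rfl)⟩

end IsGate

lemma exists_mem_mouthRect_dist_le {t m : ℝ} (hm : 0 ≤ m) (φ : (ℝ × ℝ) ≃ᵢ (ℝ × ℝ)) {s : ℝ} (r : ℝ)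
    (h0 : 0 ≤ s) (ht : s ≤ t) :
    ∃ z ∈ mouthRect t m φ, dist (φ (s, r)) z ≤ max 0 (|r| - m / 2) := by
  obtain ⟨r', h1, h2⟩ := exists_clip hm r
  refine ⟨φ (s, r'), mem_image_of_mem _ ⟨⟨h0, ht⟩, abs_le.1 h1⟩, ?_⟩
  rw [φ.dist_eq, prod_dist_le]
  exact ⟨by simp, h2⟩

/-- In the maximum metric, Lebesgue measure is the two-dimensional Hausdorff measure, an isometry
invariant. -/
lemma volume_image_isometryEquiv (φ : (ℝ × ℝ) ≃ᵢ (ℝ × ℝ)) (S : Set (ℝ × ℝ)) :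
    volume (φ '' S) = volume S := by
  rw [← hausdorffMeasure_prod_real]
  exact φ.isometry.hausdorffMeasure_image (Or.inr φ.surjective) S

/-! ### Digging in a strip -/

/-- What is left of `I` after a canal with a mouth at `φ` has been dug. -/
def dug (I : Set (ℝ × ℝ)) (t m : ℝ) (φ : ℝ × ℝ → ℝ × ℝ) : Set (ℝ × ℝ) :=
  I \ ({x | t ≤ depth I x} ∪ mouthRect t m φ)

lemma mem_dug {I : Set (ℝ × ℝ)} {t m : ℝ} {φ : ℝ × ℝ → ℝ × ℝ} {x : ℝ × ℝ} :
    x ∈ dug I t m φ ↔ x ∈ I ∧ depth I x < t ∧ x ∉ mouthRect t m φ := by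
  simp [dug]

lemma mem_mouthRect {t m : ℝ} {φ : (ℝ × ℝ) ≃ᵢ (ℝ × ℝ)} {s r : ℝ} :
    φ (s, r) ∈ mouthRect t m φ ↔ (0 ≤ s ∧ s ≤ t) ∧ |r| ≤ m / 2 := by
  rw [mouthRect, φ.injective.mem_set_image, mem_prod, mem_Icc, mem_Icc, abs_le]

lemma isClosed_mouthRect (t m : ℝ) (φ : (ℝ × ℝ) ≃ᵢ (ℝ × ℝ)) : IsClosed (mouthRect t m φ) :=
  φ.toHomeomorph.isClosedMap _ (isClosed_Icc.prod isClosed_Icc)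

namespace IsStrip

variable {I : Set (ℝ × ℝ)} {T t m l : ℝ} {φ : (ℝ × ℝ) ≃ᵢ (ℝ × ℝ)}

lemma isOpen_dug (h : IsStrip I T l) : IsOpen (dug I t m φ) :=
  h.isOpen.sdiff ((isClosed_le continuous_const continuous_depth).union (isClosed_mouthRect _ _ _))

lemma nonempty_compl_dug (h : IsStrip I T l) : (dug I t m φ)ᶜ.Nonempty :=
  h.nonempty_compl.mono (compl_subset_compl.2 sdiff_subset)

/-- The distance to the canal is determined by the depth. -/
lemma depth_dug_le_sub (h : IsStrip I T l) (hT : 2 * t < T) {x : ℝ × ℝ}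
    (hx : x ∈ dug I t m φ) : depth (dug I t m φ) x ≤ t - depth I x := by
  rw [mem_dug] at hx
  obtain ⟨y, hy1, hy2⟩ := h.exists_depth_eq hx.1 hx.2.1.le (by linarith)
  exact (depth_le_dist fun hy => (mem_dug.1 hy).2.1.ne hy2).trans hy1

lemma depth_dug_le_depth (h : IsStrip I T l) (x : ℝ × ℝ) :
    depth (dug I t m φ) x ≤ depth I x :=
  depth_mono h.nonempty_compl sdiff_subset

/-- The three conditions keep the ball of radius ρ away from the old complement, the canal and the
mouth. -/
lemma le_depth_dug (h : IsStrip I T l) {x : ℝ × ℝ} {ρ : ℝ} (h1 : ρ ≤ depth I x)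
    (h2 : ρ ≤ t - depth I x) (h3 : ∀ z ∈ mouthRect t m φ, ρ ≤ dist x z) :
    ρ ≤ depth (dug I t m φ) x := by
  refine (le_depth_iff h.nonempty_compl_dug).2 fun y hy => ?_
  rw [mem_ball'] at hy
  have h4 := depth_le_depth_add_dist (I := I) (x := x) (y := y)
  have h5 := depth_le_depth_add_dist (I := I) (x := y) (y := x)
  rw [dist_comm] at h5
  refine mem_dug.2 ⟨(depth_pos_iff h.nonempty_compl h.isOpen).1 (by linarith), by linarith,
    fun hz => ?_⟩
  have := h3 y hz
  linarith

lemma exists_depth_eq_half (h : IsStrip I T l) (ht : 0 < t) (hT : 2 * t < T) {x : ℝ × ℝ}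
    (hx : x ∈ dug I t m φ) :
    ∃ y, dist x y ≤ t / 2 - depth (dug I t m φ) x ∧ depth I y = t / 2 := by
  rcases le_total (depth I x) (t / 2) with hc | hc
  · obtain ⟨y, hy1, hy2⟩ := h.exists_depth_eq (mem_dug.1 hx).1 hc (by linarith)
    have := h.depth_dug_le_depth (t := t) (m := m) (φ := φ) x
    exact ⟨y, by linarith, hy2⟩
  · obtain ⟨y, hy1, hy2⟩ := exists_depth_eq_of_le_depth h.nonempty_compl h.isOpen
      (by linarith) hc
    have := h.depth_dug_le_sub hT hx
    exact ⟨y, by linarith, hy2⟩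

/-- Away from the mouth, the core of the new strip is the old level t/2, and moving to that level
suffices. If this leads too close to the mouth, the target is replaced by the centre of the end
square beside the mouth, on the side where the point lies. -/
lemma exists_le_depth_dug (h : IsStrip I T l) (ht : 0 < t) (hT : 2 * t < T) (hm : 0 ≤ m)
    (hg : IsGate I T t m φ) {x : ℝ × ℝ} (hx : x ∈ dug I t m φ) :
    ∃ y, dist x y ≤ t / 2 - depth (dug I t m φ) x ∧ t / 2 ≤ depth (dug I t m φ) y := by
  obtain ⟨y, hy1, hy2⟩ := h.exists_depth_eq_half ht hT hx
  by_cases hc : ∀ z ∈ mouthRect t m φ, t / 2 ≤ dist y z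
  · exact ⟨y, hy1, h.le_depth_dug hy2.ge (by linarith) hc⟩
  push Not at hc
  obtain ⟨z, hz, hyz⟩ := hc
  obtain ⟨⟨s₁, r₁⟩, rfl⟩ := φ.surjective z
  obtain ⟨⟨s₀, r₀⟩, rfl⟩ := φ.surjective y
  obtain ⟨⟨s, r⟩, rfl⟩ := φ.surjective x
  rw [mem_mouthRect] at hz
  rw [φ.dist_eq, prod_dist_lt] at hyz
  rw [φ.dist_eq, prod_dist_le] at hy1
  set σ := depth (dug I t m φ) (φ (s, r)) with hσ
  have hσ0 : 0 ≤ σ := depth_nonneg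
  dsimp only at *
  have hr₀ : |r₀| < m / 2 + t / 2 := by
    have := abs_sub_abs_le_abs_sub r₀ r₁
    linarith
  -- Near the mouth the old depth at level t/2 is simply the distance to the gate line, so `y` lies
  -- straight across from the gate.
  have hs₀ : s₀ = t / 2 := by
    have h1 := hg.depth_le hm s₀ r₀
    rw [hy2] at h1
    have h2 : t / 2 ≤ |s₀| := by
      rcases le_max_iff.1 h1 with h1 | h1 <;> linarith
    have h3 := abs_lt.1 hyz.1
    rcases le_abs.1 h2 with h2 | h2
    · by_contra hne
      have h4 : t / 2 < s₀ := lt_of_le_of_ne h2 (Ne.symm hne)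
      have h5 := hg.le_depth (ρ := min s₀ (min (T - s₀) (m / 2 + t - |r₀|))) (s := s₀) (r := r₀)
        (min_le_left _ _)
        (by have := min_le_right s₀ (min (T - s₀) (m / 2 + t - |r₀|))
            have := min_le_left (T - s₀) (m / 2 + t - |r₀|)
            linarith)
        (by have := min_le_right s₀ (min (T - s₀) (m / 2 + t - |r₀|))
            have := min_le_right (T - s₀) (m / 2 + t - |r₀|)
            linarith) hm
      rw [hy2] at h5
      have h6 : t / 2 < min s₀ (min (T - s₀) (m / 2 + t - |r₀|)) :=
        lt_min h4 (lt_min (by linarith) (by linarith))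
      linarith
    · linarith
  subst hs₀
  have hs := abs_le.1 hy1.1
  have hrM : m / 2 < |r| := by
    by_contra! hle
    exact (mem_dug.1 hx).2.2 (mem_mouthRect.2 ⟨⟨by linarith, by linarith⟩, hle⟩)
  have hrσ : m / 2 + σ ≤ |r| := by
    obtain ⟨z, hz, hxz⟩ := exists_mem_mouthRect_dist_le (t := t) hm φ (s := s) r (by linarith)
      (by linarith)
    have h1 := (depth_le_dist (I := Wada.dug I t m φ) fun hz' => (mem_dug.1 hz').2.2 hz).trans hxz
    rw [← hσ, max_eq_right (by linarith)] at h1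
    linarith
  -- The sign records on which side of the mouth the point lies; the same side is used for the new
  -- centre.
  obtain ⟨ε, hε, hrε⟩ : ∃ ε : ℝ, (ε = 1 ∨ ε = -1) ∧ r = ε * |r| := by
    rcases abs_cases r with ⟨h1, -⟩ | ⟨h1, -⟩
    · exact ⟨1, Or.inl rfl, by rw [h1]; ring⟩
    · exact ⟨-1, Or.inr rfl, by rw [h1]; ring⟩
  have hεabs : |ε| = 1 := by rcases hε with rfl | rfl <;> simp
  refine ⟨φ (t / 2, ε * (m / 2 + t / 2)), ?_, ?_⟩
  · rw [φ.dist_eq, prod_dist_le]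
    refine ⟨hy1.1, ?_⟩
    have h1 : |r - ε * (m / 2 + t / 2)| = abs (|r| - (m / 2 + t / 2)) := by
      conv_lhs => rw [hrε, ← mul_sub, abs_mul, hεabs, one_mul]
    have h2 := abs_sub_abs_le_abs_sub r r₀
    dsimp only
    rw [h1, abs_le]
    exact ⟨by linarith, by linarith⟩
  · have habs : |ε * (m / 2 + t / 2)| = m / 2 + t / 2 := by
      rw [abs_mul, hεabs, one_mul, abs_of_nonneg (by linarith)]
    have h1 : depth I (φ (t / 2, ε * (m / 2 + t / 2))) = t / 2 := by
      refine le_antisymm ?_ ?_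
      · refine (hg.depth_le hm _ _).trans ?_
        rw [habs]
        exact max_le (abs_of_pos (by linarith)).le (by linarith)
      · exact hg.le_depth le_rfl (by linarith) (by linarith) hm
    refine h.le_depth_dug h1.ge (by linarith) fun z hz => ?_
    obtain ⟨⟨s', r'⟩, rfl⟩ := φ.surjective z
    rw [mem_mouthRect] at hz
    by_contra! hlt
    rw [φ.dist_eq, prod_dist_lt] at hlt
    have := abs_sub_abs_le_abs_sub (ε * (m / 2 + t / 2)) r'
    dsimp only at *
    linarith

/-- The new depth exceeds σ exactly when the old depth is between σ and t - σ and the mouth is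
farther than σ. Of the σ-neighbourhood of the mouth, only σ < s < t - σ has to be removed: nearer to
the gate the old depth is at most σ, and further in it is at least t - σ until the neighbourhood
ends. -/
lemma setOf_lt_depth_dug (h : IsStrip I T l) (hT : 2 * t < T) (hm : 0 ≤ m)
    (hg : IsGate I T t m φ) {σ : ℝ} (h0 : 0 ≤ σ) :
    {x | σ < depth (dug I t m φ) x} =
      ({x | σ < depth I x} \ {x | t - σ ≤ depth I x}) \
        (φ '' (Ioo σ (t - σ) ×ˢ Icc (-(m / 2 + σ)) (m / 2 + σ))) := by
  ext x
  obtain ⟨⟨s, r⟩, rfl⟩ := φ.surjective x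
  simp only [mem_ofPred_eq, mem_sdiff, φ.injective.mem_set_image, mem_prod, mem_Ioo, mem_Icc, not_le,
    ← abs_le (a := r)]
  constructor
  · intro hx
    have hx' : φ (s, r) ∈ dug I t m φ :=
      (depth_pos_iff h.nonempty_compl_dug h.isOpen_dug).1 (h0.trans_lt hx)
    refine ⟨⟨hx.trans_le (h.depth_dug_le_depth _), ?_⟩, ?_⟩
    · have := h.depth_dug_le_sub hT hx'
      linarith
    · rintro ⟨⟨h1, h2⟩, h3⟩
      obtain ⟨z, hz, hxz⟩ := exists_mem_mouthRect_dist_le (t := t) hm φ (s := s) r (by linarith)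
        (by linarith)
      have h4 := (depth_le_dist (I := Wada.dug I t m φ) fun hz' => (mem_dug.1 hz').2.2 hz).trans hxz
      have h5 : max 0 (|r| - m / 2) ≤ σ := max_le h0 (by linarith)
      linarith
  · rintro ⟨⟨h1, h2⟩, h3⟩
    -- The right side is a lower bound for the distance to the mouth rectangle.
    have h4 : σ < max (|r| - m / 2) (max (-s) (s - t)) := by
      by_contra! hle
      rw [max_le_iff, max_le_iff] at hle
      obtain ⟨h5, h6, h7⟩ := hle
      refine h3 ⟨⟨?_, ?_⟩, by linarith⟩
      · have h8 := h1.trans_le (hg.depth_le hm s r)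
        have h9 : σ < |s| := by
          rcases lt_max_iff.1 h8 with h8 | h8 <;> linarith
        rcases lt_abs.1 h9 with h9 | h9 <;> linarith
      · by_contra! h8
        have := hg.le_depth (ρ := t - σ) (s := s) (r := r) h8 (by linarith) (by linarith) hm
        linarith
    set ρ := min (depth I (φ (s, r))) (min (t - depth I (φ (s, r)))
      (max (|r| - m / 2) (max (-s) (s - t)))) with hρ
    have h5 : σ < ρ := lt_min h1 (lt_min (by linarith) h4)
    refine h5.trans_le (h.le_depth_dug (min_le_left _ _)
      ((min_le_right _ _).trans (min_le_left _ _)) fun z hz => ?_)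
    refine ((min_le_right _ _).trans (min_le_right _ _)).trans ?_
    obtain ⟨⟨s', r'⟩, rfl⟩ := φ.surjective z
    rw [mem_mouthRect] at hz
    rw [φ.dist_eq, Prod.dist_eq, Real.dist_eq, Real.dist_eq]
    dsimp only
    have h6 := abs_sub_abs_le_abs_sub r r'
    refine max_le ?_ (max_le ?_ ?_)
    · exact le_max_of_le_right (by linarith)
    · exact le_max_of_le_left (le_trans (by linarith) (neg_le_abs _))
    · exact le_max_of_le_left (le_trans (by linarith) (le_abs_self _))

/-- The removed sets are nested, so areas subtract: (T - 2σ)(l - 2σ) - (T - 2t + 2σ)(l - 2t + 2σ) -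
(t - 2σ)(m + 2σ), in which t - 2σ factors out. The assumption T ≤ l keeps the factors nonnegative,
so that subtraction in `ENNReal` is not truncated. -/
lemma volume_lt_depth_dug (h : IsStrip I T l) (ht : 0 < t) (hT : 2 * t < T) (hm : 0 ≤ m)
    (hl : T ≤ l) (hg : IsGate I T t m φ) {σ : ℝ} (h0 : 0 ≤ σ) (hσ : σ < t / 2) :
    volume {x | σ < depth (dug I t m φ) x} =
      ENNReal.ofReal ((t - 2 * σ) * ((2 * l + 2 * (T - 2 * t) - m) - 2 * σ)) := by
  have hsub1 : {x | t - σ ≤ depth I x} ⊆ {x | σ < depth I x} :=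
    fun x (hx : t - σ ≤ depth I x) => lt_of_lt_of_le (by linarith) hx
  have hsub2 : φ '' (Ioo σ (t - σ) ×ˢ Icc (-(m / 2 + σ)) (m / 2 + σ)) ⊆
      {x | σ < depth I x} \ {x | t - σ ≤ depth I x} := by
    rintro _ ⟨⟨s, r⟩, ⟨⟨h1, h2⟩, h3⟩, rfl⟩
    replace h3 := abs_le.2 h3
    dsimp only at h1 h2 h3
    refine ⟨?_, ?_⟩
    · have := hg.le_depth (ρ := min s (t - σ)) (s := s) (r := r) (min_le_left _ _)
        (by have := min_le_right s (t - σ); linarith)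
        (by have := min_le_right s (t - σ); linarith) hm
      exact lt_of_lt_of_le (lt_min h1 (by linarith)) this
    · have := hg.depth_le hm s r
      rw [abs_of_pos (by linarith)] at this
      simp only [mem_ofPred_eq, not_le]
      exact this.trans_lt (max_lt h2 (by linarith))
  have hmeas1 : MeasurableSet {x | t - σ ≤ depth I x} :=
    (isClosed_le continuous_const continuous_depth).measurableSet
  have hmeas2 : MeasurableSet (φ '' (Ioo σ (t - σ) ×ˢ Icc (-(m / 2 + σ)) (m / 2 + σ))) :=
    φ.toHomeomorph.measurableEmbedding.measurableSet_image.2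
      (measurableSet_Ioo.prod measurableSet_Icc)
  have hv1 := h.volume_le_depth (s := t - σ) (by linarith) (by linarith)
  have hv2 : volume (φ '' (Ioo σ (t - σ) ×ˢ Icc (-(m / 2 + σ)) (m / 2 + σ))) =
      ENNReal.ofReal ((t - 2 * σ) * (m + 2 * σ)) := by
    rw [volume_image_isometryEquiv, Measure.volume_eq_prod, Measure.prod_prod, Real.volume_Ioo,
      Real.volume_Icc, ← ENNReal.ofReal_mul (by linarith)]
    congr 1
    ring
  rw [h.setOf_lt_depth_dug hT hm hg h0,
    measure_sdiff hsub2 hmeas2.nullMeasurableSet (by rw [hv2]; exact ENNReal.ofReal_ne_top),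
    measure_sdiff hsub1 hmeas1.nullMeasurableSet (by rw [hv1]; exact ENNReal.ofReal_ne_top),
    h.volume_lt_depth σ h0 (by linarith), hv1, hv2,
    ← ENNReal.ofReal_sub _ (mul_nonneg (by linarith) (by linarith)),
    ← ENNReal.ofReal_sub _ (mul_nonneg (by linarith) (by linarith))]
  congr 1
  ring

/-- Digging turns a strip into a longer and thinner strip. -/
theorem dug (h : IsStrip I T l) (ht : 0 < t) (hT : 2 * t < T) (hm : 0 ≤ m)
    (hl : T ≤ l) (hg : IsGate I T t m φ) :
    IsStrip (dug I t m φ) t (2 * l + 2 * (T - 2 * t) - m) where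
  isOpen := h.isOpen_dug
  nonempty_compl := h.nonempty_compl_dug
  exists_le_depth _ hx := h.exists_le_depth_dug ht hT hm hg hx
  volume_lt_depth _ h0 hs := h.volume_lt_depth_dug ht hT hm hl hg h0 hs

end IsStrip

/-! ### Frames -/

/-- The point with coordinates `x` in the frame with origin `p` and first axis `u`. -/
def frame (p u x : ℝ × ℝ) : ℝ × ℝ := (p.1 + x.1 * u.1 - x.2 * u.2, p.2 + x.1 * u.2 + x.2 * u.1)

/-- `u` is one of the four unit vectors that are parallel to an axis. -/
def IsAxis (u : ℝ × ℝ) : Prop := (|u.1| = 1 ∧ u.2 = 0) ∨ (u.1 = 0 ∧ |u.2| = 1)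

lemma IsAxis.neg {u : ℝ × ℝ} (h : IsAxis u) : IsAxis (-u) := by
  simpa [IsAxis] using h

lemma IsAxis.perp {u : ℝ × ℝ} (h : IsAxis u) : IsAxis (-u.2, u.1) := by
  rcases h with ⟨h1, h2⟩ | ⟨h1, h2⟩
  · exact Or.inr ⟨by simpa using h2, h1⟩
  · exact Or.inl ⟨by simpa using h2, h1⟩

lemma isAxis_one_zero : IsAxis (1, 0) := by simp [IsAxis]

lemma IsAxis.sq_add_sq {u : ℝ × ℝ} (h : IsAxis u) : u.1 ^ 2 + u.2 ^ 2 = 1 := by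
  rcases h with ⟨h1, h2⟩ | ⟨h1, h2⟩
  · rw [h2, ← sq_abs, h1]; norm_num
  · rw [h1, ← sq_abs u.2, h2]; norm_num

/-- For axis directions the frame only reflects and swaps coordinates, which the maximum metric does
not notice. -/
lemma IsAxis.isometry_frame {u : ℝ × ℝ} (h : IsAxis u) (p : ℝ × ℝ) : Isometry (frame p u) := by
  refine Isometry.of_dist_eq fun x y => ?_
  simp only [Prod.dist_eq, Real.dist_eq, frame]
  rcases h with ⟨h1, h2⟩ | ⟨h1, h2⟩
  · congr 1
    · rw [h2, show p.1 + x.1 * u.1 - x.2 * 0 - (p.1 + y.1 * u.1 - y.2 * 0) = (x.1 - y.1) * u.1 by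
        ring, abs_mul, h1, mul_one]
    · rw [h2, show p.2 + x.1 * 0 + x.2 * u.1 - (p.2 + y.1 * 0 + y.2 * u.1) = (x.2 - y.2) * u.1 by
        ring, abs_mul, h1, mul_one]
  · rw [max_comm]
    congr 1
    · rw [h1, show p.2 + x.1 * u.2 + x.2 * 0 - (p.2 + y.1 * u.2 + y.2 * 0) = (x.1 - y.1) * u.2 by
        ring, abs_mul, h2, mul_one]
    · rw [h1, show p.1 + x.1 * 0 - x.2 * u.2 - (p.1 + y.1 * 0 - y.2 * u.2) =
        -((x.2 - y.2) * u.2) by ring, abs_neg, abs_mul, h2, mul_one]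

/-- The frame as an isometry of the plane with the maximum metric. -/
def IsAxis.equiv {u : ℝ × ℝ} (h : IsAxis u) (p : ℝ × ℝ) : (ℝ × ℝ) ≃ᵢ (ℝ × ℝ) :=
  IsometryEquiv.mk' (frame p u)
    (fun x => ((x.1 - p.1) * u.1 + (x.2 - p.2) * u.2, -(x.1 - p.1) * u.2 + (x.2 - p.2) * u.1))
    (fun x => by
      have := h.sq_add_sq
      ext
      · simp only [frame]
        linear_combination (x.1 - p.1) * this
      · simp only [frame]
        linear_combination (x.2 - p.2) * this)
    (h.isometry_frame p)

@[simp] lemma IsAxis.coe_equiv {u : ℝ × ℝ} (h : IsAxis u) (p : ℝ × ℝ) :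
    ⇑(h.equiv p) = frame p u := rfl

lemma IsAxis.dist_frame {u : ℝ × ℝ} (h : IsAxis u) (p x y : ℝ × ℝ) :
    dist (frame p u x) (frame p u y) = dist x y := (h.isometry_frame p).dist_eq x y

lemma IsAxis.exists_frame {u : ℝ × ℝ} (h : IsAxis u) (p x : ℝ × ℝ) :
    ∃ s r, frame p u (s, r) = x := by
  obtain ⟨⟨s, r⟩, hx⟩ := (h.equiv p).surjective x
  exact ⟨s, r, hx⟩

lemma frame_one_zero (p : ℝ × ℝ) (s r : ℝ) : frame p (1, 0) (s, r) = (p.1 + s, p.2 + r) := by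
  simp [frame]

/-! ### The construction -/

section Construction

variable {a : ℕ → ℝ} {σ : ℕ → Bool}

lemma t_zero : t a 0 = 1 := by simp [t]

lemma t_succ (n : ℕ) : t a (n + 1) = t a n * (a (n + 1))⁻¹ := by
  rw [t, t, Finset.prod_Icc_succ_top (by omega)]

lemma t_pos (ha : ∀ i, 1 ≤ i → 2 < a i) (n : ℕ) : 0 < t a n := by
  refine Finset.prod_pos fun i hi => ?_
  have := ha i (Finset.mem_Icc.1 hi).1
  positivity

lemma two_mul_t_succ_lt (ha : ∀ i, 1 ≤ i → 2 < a i) (n : ℕ) : 2 * t a (n + 1) < t a n := by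
  have h1 := ha (n + 1) (by omega)
  have h2 := t_pos ha n
  rw [t_succ, ← div_eq_mul_inv, ← mul_div_assoc, div_lt_iff₀ (by linarith)]
  nlinarith

lemma t_succ_lt (ha : ∀ i, 1 ≤ i → 2 < a i) (n : ℕ) : t a (n + 1) < t a n := by
  have := two_mul_t_succ_lt ha n
  have := t_pos ha (n + 1)
  linarith

lemma w_succ (ha : ∀ i, 1 ≤ i → 2 < a i) (n : ℕ) : w a (n + 1) = t a n - 2 * t a (n + 1) := by
  have h1 := ha (n + 1) (by omega)
  rw [t_succ, w, Nat.add_sub_cancel, ← t]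
  ring

lemma w_succ_pos (ha : ∀ i, 1 ≤ i → 2 < a i) (n : ℕ) : 0 < w a (n + 1) := by
  have := two_mul_t_succ_lt ha n
  rw [w_succ ha]
  linarith

lemma mouthWidth_succ_pos (ha : ∀ i, 1 ≤ i → 2 < a i) (n : ℕ) : 0 < mouthWidth a (n + 1) := by
  rw [mouthWidth]
  split_ifs with h
  · exact w_succ_pos ha n
  · obtain ⟨k, rfl⟩ : ∃ k, n = k + 3 := ⟨n - 3, by omega⟩
    exact lt_min (w_succ_pos ha _) (w_succ_pos ha k)

lemma mouthWidth_le (n : ℕ) : mouthWidth a n ≤ w a n := by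
  rw [mouthWidth]
  split_ifs
  · exact le_rfl
  · exact min_le_left _ _

lemma mouthWidth_le_sub_three (n : ℕ) : mouthWidth a (n + 4) ≤ w a (n + 1) := by
  rw [mouthWidth, if_neg (by omega)]
  exact min_le_right _ _

lemma mouthWidth_of_le_three {n : ℕ} (hn : n ≤ 3) : mouthWidth a n = w a n := if_pos hn

lemma abs_sgn (n : ℕ) : |sgn σ n| = 1 := by
  rw [sgn]
  split_ifs <;> simp

/-- The points of the island of day `n - 1` at distance at least `t n` from its complement. -/
def eroded (a : ℕ → ℝ) (σ : ℕ → Bool) (n : ℕ) : Set (ℝ × ℝ) :=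
  {x | ball x (t a n) ⊆ island a σ (n - 1)}

/-- The frame at the starting point of the canal of day `n`. -/
noncomputable def gateFrame (a : ℕ → ℝ) (σ : ℕ → Bool) (n : ℕ) : ℝ × ℝ → ℝ × ℝ :=
  frame (gate a σ n).1 (gate a σ n).2

lemma mouth_eq (n : ℕ) : mouth a σ n = mouthRect (t a n) (mouthWidth a n) (gateFrame a σ n) := by
  ext x
  simp only [mouth, mouthRect, mem_ofPred_eq, mem_image, Prod.exists, mem_prod, mem_Icc, gateFrame,
    ← abs_le]
  refine exists_congr fun s => exists_congr fun r => ?_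
  have : (gate a σ n).1 + s • (gate a σ n).2 + r • (-(gate a σ n).2.2, (gate a σ n).2.1) =
      frame (gate a σ n).1 (gate a σ n).2 (s, r) := by
    ext <;> simp [frame]
    ring
  rw [this, eq_comm (a := x)]
  tauto

lemma canal_eq (n : ℕ) : canal a σ n = eroded a σ n ∪ mouth a σ n := rfl

lemma island_succ (n : ℕ) : island a σ (n + 1) = island a σ n \ canal a σ (n + 1) := rfl

lemma island_succ_subset (n : ℕ) : island a σ (n + 1) ⊆ island a σ n := sdiff_subset

lemma island_antitone : Antitone (island a σ) := antitone_nat_of_succ_le island_succ_subset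

lemma island_subset_unitSquare (n : ℕ) : island a σ n ⊆ unitSquare :=
  island_antitone (Nat.zero_le n)

lemma notMem_island_of_fst_nonpos {n : ℕ} {x : ℝ × ℝ} (hx : x.1 ≤ 0) : x ∉ island a σ n :=
  fun h => (island_subset_unitSquare n h).1.1.not_ge hx

lemma nonempty_compl_island (n : ℕ) : (island a σ n)ᶜ.Nonempty :=
  ⟨(0, 0), notMem_island_of_fst_nonpos le_rfl⟩

lemma eroded_succ_subset (ha : ∀ i, 1 ≤ i → 2 < a i) (n : ℕ) :
    eroded a σ (n + 1) ⊆ island a σ n := fun _ hx => hx (mem_ball_self (t_pos ha _))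

lemma notMem_island_of_mem_eroded {n : ℕ} {x : ℝ × ℝ} (hx : x ∈ eroded a σ (n + 1)) :
    x ∉ island a σ (n + 1) := fun h => h.2 (Or.inl hx)

lemma t_le_dist_of_mem_eroded {n : ℕ} {x y : ℝ × ℝ} (hx : x ∈ eroded a σ (n + 1))
    (hy : y ∉ island a σ n) : t a (n + 1) ≤ dist x y := by
  by_contra! h
  exact hy (hx (mem_ball'.2 h))

lemma mem_island_succ {n : ℕ} {x : ℝ × ℝ} :
    x ∈ island a σ (n + 1) ↔
      x ∈ island a σ n ∧ x ∉ eroded a σ (n + 1) ∧ x ∉ mouth a σ (n + 1) := by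
  rw [island_succ, canal_eq]
  simp

/-- The canal of day `n` starts where it should. -/
structure GoodGate (a : ℕ → ℝ) (σ : ℕ → Bool) (n : ℕ) : Prop where
  isAxis : IsAxis (gate a σ n).2
  isGate : IsGate (island a σ (n - 1)) (t a (n - 1)) (t a n) (mouthWidth a n) (gateFrame a σ n)
  face : 4 ≤ n → ∀ r, |r| ≤ mouthWidth a n / 2 → gateFrame a σ n (0, r) ∈ eroded a σ (n - 3)

lemma GoodGate.exists_mem_eroded {n : ℕ} (h : GoodGate a σ (n + 4)) {x : ℝ × ℝ}
    (hx : x ∈ mouth a σ (n + 4)) : ∃ z ∈ eroded a σ (n + 1), dist x z ≤ t a (n + 4) := by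
  rw [mouth_eq] at hx
  obtain ⟨⟨s, r⟩, ⟨⟨h1, h2⟩, h3⟩, rfl⟩ := hx
  refine ⟨gateFrame a σ (n + 4) (0, r), h.face (by omega) r (abs_le.2 h3), ?_⟩
  rw [gateFrame, h.isAxis.dist_frame, prod_dist_le]
  dsimp only at h1 h2
  have : t a (n + 4) ≥ 0 := h1.trans h2
  simp [abs_of_nonneg h1, h2, this]

/-- On both sides of the mouth a square belongs to the new island. -/
lemma GoodGate.mem_island (ha : ∀ i, 1 ≤ i → 2 < a i) {n : ℕ} (h : GoodGate a σ (n + 1))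
    {s ρ ε : ℝ} (hε : |ε| = 1) (h1 : 0 < s) (h2 : s < t a (n + 1)) (h3 : 0 < ρ)
    (h4 : ρ < t a (n + 1)) :
    gateFrame a σ (n + 1) (s, ε * (mouthWidth a (n + 1) / 2 + ρ)) ∈ island a σ (n + 1) := by
  have hm := mouthWidth_succ_pos ha n
  have habs : |ε * (mouthWidth a (n + 1) / 2 + ρ)| = mouthWidth a (n + 1) / 2 + ρ := by
    rw [abs_mul, hε, one_mul, abs_of_pos (by linarith)]
  rw [mem_island_succ]
  refine ⟨h.isGate.mem _ _ h1 (h2.trans (t_succ_lt ha n)) (by rw [habs]; linarith), fun hx => ?_,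
    fun hx => ?_⟩
  · have hf := h.isGate.notMem (ε * (mouthWidth a (n + 1) / 2))
      (by rw [abs_mul, hε, one_mul, abs_of_pos (by linarith)])
    have := t_le_dist_of_mem_eroded hx hf
    rw [gateFrame, h.isAxis.dist_frame] at this
    refine this.not_gt (prod_dist_lt.2 ⟨?_, ?_⟩)
    · simpa [abs_of_pos h1] using h2
    · dsimp only
      rw [← mul_sub, abs_mul, hε, one_mul, add_sub_cancel_left, abs_of_pos h3]
      exact h4
  · rw [mouth_eq] at hx
    have := ((mem_mouthRect (φ := h.isAxis.equiv (gate a σ (n + 1)).1)).1 hx).2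
    rw [habs] at this
    linarith

/-- One of the ends of the island of day `m` is at `q`, and the island extends from there in the
direction `e`. -/
structure IsEnd (a : ℕ → ℝ) (σ : ℕ → Bool) (m : ℕ) (q e : ℝ × ℝ) : Prop where
  isAxis : IsAxis e
  mem : ∀ s r, 0 < s → s < t a m → |r| < t a m / 2 → frame q e (s, r) ∈ island a σ m
  notMem : ∀ r, |r| ≤ t a m / 2 → frame q e (0, r) ∉ island a σ m

/-- The part of the island that separates the peak near the end `q` from the canal of day `m + 4`.
-/
def peakRegion (a : ℕ → ℝ) (m : ℕ) (q e : ℝ × ℝ) : Set (ℝ × ℝ) :=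
  {x | ∃ s r, t a (m + 1) - t a (m + 3) < s ∧ s < t a (m + 1) ∧
    |r| < w a (m + 1) / 2 + t a (m + 3) ∧ frame q e (s, r) = x}

/-- These points form the end face of the next canal: w (m+1) + 2 t (m+1) = t m, so their squares of
radius t (m+1) just fit into the end square. -/
lemma IsEnd.mem_eroded (ha : ∀ i, 1 ≤ i → 2 < a i) {m : ℕ} {q e : ℝ × ℝ} (h : IsEnd a σ m q e)
    {r : ℝ} (hr : |r| ≤ w a (m + 1) / 2) : frame q e (t a (m + 1), r) ∈ eroded a σ (m + 1) := by
  intro y hy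
  obtain ⟨s', r', rfl⟩ := h.isAxis.exists_frame q y
  rw [mem_ball, h.isAxis.dist_frame, prod_dist_lt] at hy
  dsimp only at hy
  obtain ⟨h1, h2⟩ := hy
  rw [abs_lt] at h1
  have h3 := abs_sub_abs_le_abs_sub r' r
  have h4 := two_mul_t_succ_lt ha m
  rw [w_succ ha] at hr
  exact h.mem _ _ (by linarith) (by linarith) (by linarith)

lemma IsEnd.exists_mem_eroded (ha : ∀ i, 1 ≤ i → 2 < a i) {m : ℕ} {q e x : ℝ × ℝ}
    (h : IsEnd a σ m q e) (hx : x ∈ peakRegion a m q e) :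
    ∃ z ∈ eroded a σ (m + 1), dist x z < t a (m + 3) := by
  obtain ⟨s, r, h1, h2, h3, rfl⟩ := hx
  obtain ⟨r', h4, h5⟩ := exists_clip (w_succ_pos ha m).le r
  refine ⟨_, h.mem_eroded ha h4, ?_⟩
  rw [h.isAxis.dist_frame, prod_dist_lt]
  refine ⟨?_, h5.trans_lt (max_lt (t_pos ha _) (by linarith))⟩
  rw [abs_of_neg (by linarith)]
  dsimp only
  linarith

/-- The canal that starts at the peak near an end of the island. -/
lemma IsEnd.goodGate (ha : ∀ i, 1 ≤ i → 2 < a i) {m : ℕ} {q e : ℝ × ℝ} (h : IsEnd a σ m q e)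
    (h1 : ∀ x ∈ peakRegion a m q e, x ∉ mouth a σ (m + 1))
    (h2 : ∀ x ∈ peakRegion a m q e, x ∉ mouth a σ (m + 2))
    (h3 : ∀ x ∈ peakRegion a m q e, x ∉ mouth a σ (m + 3))
    (hp : (gate a σ (m + 4)).1 = q + t a (m + 1) • e) (hu : (gate a σ (m + 4)).2 = -e) :
    GoodGate a σ (m + 4) := by
  have hw := mouthWidth_le_sub_three (a := a) m
  have hframe : ∀ s r, gateFrame a σ (m + 4) (s, r) = frame q e (t a (m + 1) - s, -r) := by
    intro s r
    rw [gateFrame, hp, hu]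
    ext <;> simp [frame] <;> ring
  have hface : ∀ r, |r| ≤ mouthWidth a (m + 4) / 2 →
      gateFrame a σ (m + 4) (0, r) ∈ eroded a σ (m + 1) := by
    intro r hr
    rw [hframe, sub_zero]
    exact h.mem_eroded ha (by rw [abs_neg]; linarith)
  have ht1 := two_mul_t_succ_lt ha m
  have ht2 := t_succ_lt ha (m + 1)
  have ht3 := t_succ_lt ha (m + 2)
  have ht4 := t_succ_lt ha (m + 3)
  refine ⟨by rw [hu]; exact h.isAxis.neg, ⟨fun s r hs hs' hr => ?_, fun r hr hx => ?_⟩,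
    fun _ => hface⟩
  · rw [Nat.add_sub_cancel_right (m + 3) 1] at hs'
    rw [hframe]
    have hx : frame q e (t a (m + 1) - s, -r) ∈ peakRegion a m q e :=
      ⟨_, _, by linarith, by linarith, by rw [abs_neg]; linarith, rfl⟩
    have hr' : |-r| < t a m / 2 := by
      rw [abs_neg]
      rw [w_succ ha] at hw
      linarith
    obtain ⟨z, hz, hxz⟩ := h.exists_mem_eroded ha hx
    have hz1 := notMem_island_of_mem_eroded hz
    refine mem_island_succ.2 ⟨mem_island_succ.2 ⟨mem_island_succ.2
      ⟨h.mem _ _ (by linarith) (by linarith) hr', fun hE => ?_, h1 _ hx⟩, fun hE => ?_, h2 _ hx⟩,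
      fun hE => ?_, h3 _ hx⟩
    -- The canal of day m+1 keeps distance t (m+1) from the end, and the region is nearer than that.
    · have := t_le_dist_of_mem_eroded hE (h.notMem (-r) hr'.le)
      rw [h.isAxis.dist_frame] at this
      refine this.not_gt (prod_dist_lt.2 ⟨?_, by simpa using by linarith⟩)
      dsimp only
      rw [sub_zero, abs_of_pos] <;> linarith
    -- The next two canals keep distances t (m+2) and t (m+3) from the face of canal m+1, but the
    -- region is within t (m+3) of it.
    · have := t_le_dist_of_mem_eroded hE hz1
      linarith
    · have := t_le_dist_of_mem_eroded hE fun hz2 => hz1 (island_succ_subset _ hz2)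
      linarith
  · exact notMem_island_of_mem_eroded (hface r hr)
      (island_antitone (by omega : m + 1 ≤ m + 4 - 1) hx)

/-- The region hugs canal m+3 and the mouth hugs canal m+1; these two canals are at least t (m+3)
apart. -/
lemma IsEnd.notMem_mouth_add_two (ha : ∀ i, 1 ≤ i → 2 < a i) {m : ℕ} {q e : ℝ × ℝ}
    (h : IsEnd a σ (m + 2) q e) (hg : GoodGate a σ (m + 4)) :
    ∀ x ∈ peakRegion a (m + 2) q e, x ∉ mouth a σ (m + 4) := by
  intro x hx hxM
  obtain ⟨z, hz, hxz⟩ := h.exists_mem_eroded ha hx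
  obtain ⟨y, hy, hxy⟩ := hg.exists_mem_eroded hxM
  have h1 := t_le_dist_of_mem_eroded hz
    fun hy' => notMem_island_of_mem_eroded hy (island_antitone (by omega : m + 1 ≤ m + 2) hy')
  have h2 := dist_triangle_left z y x
  have h3 := two_mul_t_succ_lt ha (m + 3)
  have h4 := t_succ_lt ha (m + 4)
  have : m + 2 + 1 = m + 3 := rfl
  have : m + 2 + 3 = m + 5 := rfl
  have : m + 3 + 1 = m + 4 := rfl
  have : m + 4 + 1 = m + 5 := rfl
  simp only [*] at *
  linarith

/-- Here the region hugs canal m+2 and the mouth hugs canal m+1; these are at least t (m+2) apart.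
-/
lemma IsEnd.notMem_mouth_add_three (ha : ∀ i, 1 ≤ i → 2 < a i) {m : ℕ} {q e : ℝ × ℝ}
    (h : IsEnd a σ (m + 1) q e) (hg : GoodGate a σ (m + 4)) :
    ∀ x ∈ peakRegion a (m + 1) q e, x ∉ mouth a σ (m + 4) := by
  intro x hx hxM
  obtain ⟨z, hz, hxz⟩ := h.exists_mem_eroded ha hx
  obtain ⟨y, hy, hxy⟩ := hg.exists_mem_eroded hxM
  have h1 : t a (m + 2) ≤ _ := t_le_dist_of_mem_eroded hz (notMem_island_of_mem_eroded hy)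
  have h2 := dist_triangle_left z y x
  have h3 : 2 * t a (m + 3) < t a (m + 2) := two_mul_t_succ_lt ha (m + 2)
  have h4 : t a (m + 4) < t a (m + 3) := t_succ_lt ha (m + 3)
  have h5 : dist x z < t a (m + 4) := hxz
  linarith

/-- The mouth stays near canal m+1, which is at least t (m+1) from the complement of island m, while
`hq` puts the end, and hence the region, close to that complement. -/
lemma IsEnd.notMem_mouth_add_one (ha : ∀ i, 1 ≤ i → 2 < a i) {m : ℕ} {q e : ℝ × ℝ}
    (h : IsEnd a σ (m + 3) q e) (hg : GoodGate a σ (m + 4))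
    (hq : ∀ r, |r| ≤ t a (m + 3) / 2 →
      ∃ y ∉ island a σ m, dist (frame q e (0, r)) y ≤ t a (m + 3)) :
    ∀ x ∈ peakRegion a (m + 3) q e, x ∉ mouth a σ (m + 4) := by
  rintro _ ⟨s, r, hs1, hs2, hr, rfl⟩ hxM
  change t a (m + 4) - t a (m + 6) < s at hs1
  change s < t a (m + 4) at hs2
  change |r| < w a (m + 4) / 2 + t a (m + 6) at hr
  have h1 : 2 * t a (m + 2) < t a (m + 1) := two_mul_t_succ_lt ha (m + 1)
  have h2 : 2 * t a (m + 3) < t a (m + 2) := two_mul_t_succ_lt ha (m + 2)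
  have h3 : 2 * t a (m + 4) < t a (m + 3) := two_mul_t_succ_lt ha (m + 3)
  have h4 : t a (m + 5) < t a (m + 4) := t_succ_lt ha (m + 4)
  have h5 : t a (m + 6) < t a (m + 5) := t_succ_lt ha (m + 5)
  have h6 : w a (m + 4) = t a (m + 3) - 2 * t a (m + 4) := w_succ ha (m + 3)
  have h7 := t_pos ha (m + 4)
  obtain ⟨z, hz, hxz⟩ := hg.exists_mem_eroded hxM
  obtain ⟨y, hy, hy'⟩ := hq r (by linarith)
  have h8 := t_le_dist_of_mem_eroded hz hy
  have h10 : dist (frame q e (s, r)) (frame q e (0, r)) ≤ t a (m + 4) := by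
    rw [h.isAxis.dist_frame, prod_dist_le]
    refine ⟨?_, by simpa using h7.le⟩
    dsimp only
    rw [sub_zero, abs_of_pos] <;> linarith
  have h11 := dist_triangle_left z y (frame q e (s, r))
  have h12 := dist_triangle (frame q e (s, r)) (frame q e (0, r)) y
  linarith

end Construction

section Gates

variable {a : ℕ → ℝ} {σ : ℕ → Bool}

/-! ### The ends of the island on the left side of the square -/

lemma gateFrame_of_left {n : ℕ} {y : ℝ} (hg : gate a σ n = ((0, y), (1, 0))) (s r : ℝ) :
    gateFrame a σ n (s, r) = (s, y + r) := by
  rw [gateFrame, hg, frame_one_zero, zero_add]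

lemma mem_mouth_of_left {n : ℕ} {y : ℝ} (hg : gate a σ n = ((0, y), (1, 0))) {x : ℝ × ℝ}
    (hx : x ∈ mouth a σ n) : x.1 ≤ t a n ∧ |x.2 - y| ≤ mouthWidth a n / 2 := by
  rw [mouth_eq] at hx
  obtain ⟨⟨s, r⟩, ⟨⟨-, h2⟩, h3⟩, rfl⟩ := hx
  rw [gateFrame_of_left hg]
  exact ⟨h2, by simpa using abs_le.2 h3⟩

lemma IsEnd.goodGate_of_left {n : ℕ} {y : ℝ} (ha : ∀ i, 1 ≤ i → 2 < a i) (hn : n + 1 ≤ 3)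
    (h : IsEnd a σ n (0, y) (1, 0)) (hg : gate a σ (n + 1) = ((0, y), (1, 0))) :
    GoodGate a σ (n + 1) := by
  have hf : gateFrame a σ (n + 1) = frame (0, y) (1, 0) := by rw [gateFrame, hg]
  have ht := t_pos ha (n + 1)
  refine ⟨by rw [hg]; exact isAxis_one_zero, ⟨fun s r hs hs' hr => ?_, fun r hr => ?_⟩,
    fun h4 => by omega⟩
  · rw [hf]
    rw [mouthWidth_of_le_three hn, w_succ ha] at hr
    exact h.mem s r hs hs' (by linarith)
  · rw [hf]
    rw [mouthWidth_of_le_three hn, w_succ ha] at hr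
    exact h.notMem r (by linarith)

lemma GoodGate.isEnd_of_left {n : ℕ} {y ε : ℝ} (ha : ∀ i, 1 ≤ i → 2 < a i)
    (h : GoodGate a σ (n + 1)) (hn : n + 1 ≤ 3) (hg : gate a σ (n + 1) = ((0, y), (1, 0)))
    (hε : |ε| = 1) :
    IsEnd a σ (n + 1) (0, y + ε * (w a (n + 1) / 2 + t a (n + 1) / 2)) (1, 0) := by
  have hε2 : ε * ε = 1 := by rw [← abs_mul_abs_self, hε, one_mul]
  refine ⟨isAxis_one_zero, fun s r hs hs' hr => ?_, fun r _ => ?_⟩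
  · have hr' : |ε * r| < t a (n + 1) / 2 := by rwa [abs_mul, hε, one_mul]
    rw [abs_lt] at hr'
    have := h.mem_island ha (ρ := t a (n + 1) / 2 + ε * r) hε hs hs' (by linarith) (by linarith)
    rw [gateFrame_of_left hg, mouthWidth_of_le_three hn] at this
    rw [frame_one_zero]
    convert this using 2
    · simp
    · linear_combination (-r) * hε2
  · exact notMem_island_of_fst_nonpos (by simp [frame])

lemma isEnd_zero_left : IsEnd a σ 0 (0, 1 / 2) (1, 0) := by
  refine ⟨isAxis_one_zero, fun s r hs hs' hr => ?_, fun r _ => ?_⟩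
  · rw [t_zero] at hs' hr
    rw [abs_lt] at hr
    rw [frame_one_zero]
    refine ⟨⟨?_, ?_⟩, ⟨?_, ?_⟩⟩ <;> dsimp only <;> linarith
  · exact notMem_island_of_fst_nonpos (by simp [frame])

lemma isEnd_zero_right : IsEnd a σ 0 (1, 1 / 2) (-1, 0) := by
  have hf : ∀ s r, frame (1, 1 / 2) (-1, 0) (s, r) = (1 - s, 1 / 2 - r) := by
    intro s r
    ext <;> simp [frame] <;> ring
  refine ⟨by simp [IsAxis], fun s r hs hs' hr => ?_, fun r _ => ?_⟩
  · rw [t_zero] at hs' hr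
    rw [abs_lt] at hr
    rw [hf]
    refine ⟨⟨?_, ?_⟩, ⟨?_, ?_⟩⟩ <;> dsimp only <;> linarith
  · rw [hf]
    exact fun h => h.1.2.ne (by simp)

lemma goodGate_one (ha : ∀ i, 1 ≤ i → 2 < a i) : GoodGate a σ 1 :=
  isEnd_zero_left.goodGate_of_left ha (by norm_num) (by rw [gate])

lemma w_one (ha : ∀ i, 1 ≤ i → 2 < a i) : w a 1 = 1 - 2 * t a 1 := by
  rw [w_succ ha 0, t_zero]

lemma isEnd_one_lower (ha : ∀ i, 1 ≤ i → 2 < a i) : IsEnd a σ 1 (0, t a 1 / 2) (1, 0) := by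
  convert (goodGate_one (σ := σ) ha).isEnd_of_left ha (by norm_num) (by rw [gate]) (ε := -1) (by simp)
    using 2
  rw [zero_add, w_one ha]
  ring

lemma isEnd_one_upper (ha : ∀ i, 1 ≤ i → 2 < a i) : IsEnd a σ 1 (0, 1 - t a 1 / 2) (1, 0) := by
  convert (goodGate_one (σ := σ) ha).isEnd_of_left ha (by norm_num) (by rw [gate]) (ε := 1) (by simp)
    using 2
  rw [zero_add, w_one ha]
  ring

lemma goodGate_two (ha : ∀ i, 1 ≤ i → 2 < a i) : GoodGate a σ 2 :=
  (isEnd_one_lower ha).goodGate_of_left ha (by norm_num) (by rw [gate])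

lemma isEnd_two (ha : ∀ i, 1 ≤ i → 2 < a i) {ε : ℝ} (hε : |ε| = 1) :
    IsEnd a σ 2 (0, t a 1 / 2 + ε * (w a 2 / 2 + t a 2 / 2)) (1, 0) :=
  (goodGate_two ha).isEnd_of_left ha (by norm_num) (by rw [gate]) hε

lemma goodGate_three (ha : ∀ i, 1 ≤ i → 2 < a i) : GoodGate a σ 3 :=
  (isEnd_two ha (abs_sgn _)).goodGate_of_left ha (by norm_num) (by rw [gate])

lemma isEnd_three (ha : ∀ i, 1 ≤ i → 2 < a i) {ε : ℝ} (hε : |ε| = 1) :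
    IsEnd a σ 3 (0, t a 1 / 2 + sgn σ 3 * (w a 2 / 2 + t a 2 / 2) + ε * (w a 3 / 2 + t a 3 / 2))
      (1, 0) :=
  (goodGate_three ha).isEnd_of_left ha (by norm_num) (by rw [gate]) hε

/-! ### The starting points of all canals -/

lemma t_one_lt (ha : ∀ i, 1 ≤ i → 2 < a i) : 2 * t a 1 < 1 := by
  have := two_mul_t_succ_lt ha 0
  rwa [t_zero] at this

lemma goodGate_four (ha : ∀ i, 1 ≤ i → 2 < a i) : GoodGate a σ 4 := by
  have h1 := t_one_lt ha
  have h2 : t a 2 < t a 1 := t_succ_lt ha 1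
  have h3 : t a 3 < t a 2 := t_succ_lt ha 2
  -- The first three mouths stay within t 1 of the left side, while this peak is near the right
  -- side.
  have hR : ∀ x ∈ peakRegion a 0 (1, 1 / 2) (-1, 0), t a 1 < x.1 := by
    rintro _ ⟨s, r, -, hs, -, rfl⟩
    change s < t a 1 at hs
    simp only [frame]
    linarith
  refine (isEnd_zero_right (a := a) (σ := σ)).goodGate ha (fun x hx hM => ?_) (fun x hx hM => ?_)
    (fun x hx hM => ?_) ?_ ?_
  · exact (hR x hx).not_ge (mem_mouth_of_left (by rw [gate]) hM).1
  · have : x.1 ≤ t a 2 := (mem_mouth_of_left (by rw [gate]) hM).1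
    have := hR x hx
    linarith
  · have : x.1 ≤ t a 3 := (mem_mouth_of_left (by rw [gate]) hM).1
    have := hR x hx
    linarith
  · rw [gate]
    ext <;> simp
    ring
  · rw [gate]
    ext <;> simp

lemma mem_peakRegion_left {m : ℕ} {y : ℝ} {x : ℝ × ℝ} (hx : x ∈ peakRegion a m (0, y) (1, 0)) :
    |x.2 - y| < w a (m + 1) / 2 + t a (m + 3) := by
  obtain ⟨s, r, -, -, hr, rfl⟩ := hx
  simpa [frame] using hr

lemma goodGate_five (ha : ∀ i, 1 ≤ i → 2 < a i) : GoodGate a σ 5 := by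
  have h1 := t_one_lt ha
  have h2 : 2 * t a 2 < t a 1 := two_mul_t_succ_lt ha 1
  have h3 : 2 * t a 3 < t a 2 := two_mul_t_succ_lt ha 2
  have h4 : t a 4 < t a 3 := t_succ_lt ha 3
  have hw2 : w a 2 = t a 1 - 2 * t a 2 := w_succ ha 1
  have hw3 : w a 3 = t a 2 - 2 * t a 3 := w_succ ha 2
  have h5 := t_pos ha 3
  -- Mouths 2 and 3 lie in the lower arm of the first island, at height at most t 1; this peak is in
  -- the upper arm.
  have hR : ∀ x ∈ peakRegion a 1 (0, 1 - t a 1 / 2) (1, 0), t a 1 < x.2 := by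
    intro x hx
    have h : |x.2 - (1 - t a 1 / 2)| < w a 2 / 2 + t a 4 := mem_peakRegion_left hx
    rw [abs_lt] at h
    linarith
  refine (isEnd_one_upper ha).goodGate ha (fun x hx hM => ?_) (fun x hx hM => ?_)
    ((isEnd_one_upper ha).notMem_mouth_add_three ha (goodGate_four ha)) ?_ ?_
  · have h : |x.2 - t a 1 / 2| ≤ mouthWidth a 2 / 2 := (mem_mouth_of_left (by rw [gate]) hM).2
    rw [mouthWidth_of_le_three (by norm_num), abs_le] at h
    have := hR x hx
    linarith
  · have h : |x.2 - (t a 1 / 2 + sgn σ 3 * (w a 2 / 2 + t a 2 / 2))| ≤ mouthWidth a 3 / 2 :=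
      (mem_mouth_of_left (by rw [gate]) hM).2
    rw [mouthWidth_of_le_three (by norm_num), abs_le] at h
    have := hR x hx
    have h6 : sgn σ 3 * (w a 2 / 2 + t a 2 / 2) ≤ w a 2 / 2 + t a 2 / 2 := by
      refine (le_abs_self _).trans ?_
      rw [abs_mul, abs_sgn, one_mul, abs_of_nonneg (by linarith)]
    linarith
  · rw [gate]
    ext <;> simp
  · rw [gate]
    ext <;> simp

lemma goodGate_six (ha : ∀ i, 1 ≤ i → 2 < a i) : GoodGate a σ 6 := by
  have h3 : 2 * t a 3 < t a 2 := two_mul_t_succ_lt ha 2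
  have h4 : t a 4 < t a 3 := t_succ_lt ha 3
  have h5 : t a 5 < t a 4 := t_succ_lt ha 4
  have hw2 : 0 < w a 2 := w_succ_pos ha 1
  have hw3 : w a 3 = t a 2 - 2 * t a 3 := w_succ ha 2
  have hpos := t_pos ha 3
  -- The peak is at the end not chosen for mouth 3. The centre heights of the two ends differ by w 2
  -- + t 2, which separates region and mouth.
  have hE := isEnd_two (σ := σ) ha (ε := -sgn σ 3) (by rw [abs_neg, abs_sgn])
  refine hE.goodGate ha (fun x hx hM => ?_) (hE.notMem_mouth_add_two ha (goodGate_four ha))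
    (hE.notMem_mouth_add_three ha (goodGate_five ha)) ?_ ?_
  · have h : |x.2 - (t a 1 / 2 + sgn σ 3 * (w a 2 / 2 + t a 2 / 2))| ≤ mouthWidth a 3 / 2 :=
      (mem_mouth_of_left (by rw [gate]) hM).2
    rw [mouthWidth_of_le_three (by norm_num)] at h
    have h' : |x.2 - (t a 1 / 2 + -sgn σ 3 * (w a 2 / 2 + t a 2 / 2))| < w a 3 / 2 + t a 5 :=
      mem_peakRegion_left hx
    have h6 : |sgn σ 3 * (w a 2 + t a 2)| = w a 2 + t a 2 := by
      rw [abs_mul, abs_sgn, one_mul, abs_of_nonneg (by linarith)]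
    have h7 := abs_sub (x.2 - (t a 1 / 2 + -sgn σ 3 * (w a 2 / 2 + t a 2 / 2)))
      (x.2 - (t a 1 / 2 + sgn σ 3 * (w a 2 / 2 + t a 2 / 2)))
    rw [show x.2 - (t a 1 / 2 + -sgn σ 3 * (w a 2 / 2 + t a 2 / 2)) -
      (x.2 - (t a 1 / 2 + sgn σ 3 * (w a 2 / 2 + t a 2 / 2))) = sgn σ 3 * (w a 2 + t a 2) by ring,
      h6] at h7
    linarith
  · rw [gate]
    ext <;> simp
    ring
  · rw [gate]
    ext <;> simp

lemma goodGate_seven (ha : ∀ i, 1 ≤ i → 2 < a i) : GoodGate a σ 7 := by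
  have hE := isEnd_three (σ := σ) ha (ε := sgn σ 7) (abs_sgn _)
  refine hE.goodGate ha (hE.notMem_mouth_add_one ha (goodGate_four ha) fun r _ => ?_)
    (hE.notMem_mouth_add_two ha (goodGate_five ha))
    (hE.notMem_mouth_add_three ha (goodGate_six ha)) ?_ ?_
  · refine ⟨_, notMem_island_of_fst_nonpos ?_, (dist_self _).trans_le (t_pos ha _).le⟩
    simp [frame]
  · rw [gate]
    ext <;> simp
  · rw [gate]
    ext <;> simp

/-- A new mouth cuts the strip: each of its two long sides is an end face of width t (n+1), with the
strip running off perpendicular to the mouth. -/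
lemma GoodGate.isEnd (ha : ∀ i, 1 ≤ i → 2 < a i) {n : ℕ} (h : GoodGate a σ (n + 1)) {ε : ℝ}
    (hε : |ε| = 1) :
    IsEnd a σ (n + 1) (gateFrame a σ (n + 1) (t a (n + 1) / 2, ε * (mouthWidth a (n + 1) / 2)))
      (ε • (-(gate a σ (n + 1)).2.2, (gate a σ (n + 1)).2.1)) := by
  have hε2 : ε = 1 ∨ ε = -1 := by
    rcases abs_cases ε with ⟨h1, -⟩ | ⟨h1, -⟩
    · exact Or.inl (by linarith)
    · exact Or.inr (by linarith)
  have hm := mouthWidth_succ_pos ha n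
  have hf : ∀ s r, frame (gateFrame a σ (n + 1) (t a (n + 1) / 2, ε * (mouthWidth a (n + 1) / 2)))
      (ε • (-(gate a σ (n + 1)).2.2, (gate a σ (n + 1)).2.1)) (s, r) =
      gateFrame a σ (n + 1) (t a (n + 1) / 2 - ε * r, ε * (mouthWidth a (n + 1) / 2 + s)) := by
    intro s r
    ext <;> simp [frame, gateFrame] <;> ring
  refine ⟨?_, fun s r hs hs' hr => ?_, fun r hr => ?_⟩
  · rcases hε2 with rfl | rfl
    · simpa using h.isAxis.perp
    · rw [neg_one_smul]
      exact h.isAxis.perp.neg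
  · have hr' : |ε * r| < t a (n + 1) / 2 := by rwa [abs_mul, hε, one_mul]
    rw [abs_lt] at hr'
    rw [hf]
    exact h.mem_island ha hε (by linarith) (by linarith) hs hs'
  · have hr' : |ε * r| ≤ t a (n + 1) / 2 := by rwa [abs_mul, hε, one_mul]
    rw [abs_le] at hr'
    rw [hf, add_zero]
    refine fun hx => (mem_island_succ.1 hx).2.2 ?_
    rw [mouth_eq]
    refine (mem_mouthRect (φ := h.isAxis.equiv (gate a σ (n + 1)).1)).2
      ⟨⟨by linarith, by linarith⟩, ?_⟩
    rw [abs_mul, hε, one_mul, abs_of_pos (by linarith)]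

lemma goodGate_add_eight (ha : ∀ i, 1 ≤ i → 2 < a i) {n : ℕ} (h4 : GoodGate a σ (n + 4))
    (h5 : GoodGate a σ (n + 5)) (h6 : GoodGate a σ (n + 6)) (h7 : GoodGate a σ (n + 7)) :
    GoodGate a σ (n + 8) := by
  have hE := h4.isEnd ha (ε := sgn σ (n + 8)) (abs_sgn _)
  refine hE.goodGate ha (hE.notMem_mouth_add_one ha h5 fun r hr => ?_)
    (hE.notMem_mouth_add_two ha h6) (hE.notMem_mouth_add_three ha h7) ?_ ?_
  -- The end face is a side of mouth n+4, which is attached to canal n+1; this supplies nearby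
  -- points outside island n+1.
  · have hM : frame (gateFrame a σ (n + 4) (t a (n + 4) / 2,
        sgn σ (n + 8) * (mouthWidth a (n + 4) / 2)))
        (sgn σ (n + 8) • (-(gate a σ (n + 4)).2.2, (gate a σ (n + 4)).2.1)) (0, r) ∈
        mouth a σ (n + 4) := by
      have hf : frame (gateFrame a σ (n + 4) (t a (n + 4) / 2,
          sgn σ (n + 8) * (mouthWidth a (n + 4) / 2)))
          (sgn σ (n + 8) • (-(gate a σ (n + 4)).2.2, (gate a σ (n + 4)).2.1)) (0, r) =
          gateFrame a σ (n + 4) (t a (n + 4) / 2 - sgn σ (n + 8) * r,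
            sgn σ (n + 8) * (mouthWidth a (n + 4) / 2)) := by
        ext <;> simp [frame, gateFrame] <;> ring
      have hr' : |sgn σ (n + 8) * r| ≤ t a (n + 4) / 2 := by rwa [abs_mul, abs_sgn, one_mul]
      rw [abs_le] at hr'
      have hm := mouthWidth_succ_pos ha (n + 3)
      rw [hf, mouth_eq]
      refine (mem_mouthRect (φ := h4.isAxis.equiv (gate a σ (n + 4)).1)).2
        ⟨⟨by linarith, by linarith⟩, ?_⟩
      rw [abs_mul, abs_sgn, one_mul, abs_of_pos (by linarith)]
    obtain ⟨z, hz, hz'⟩ := h4.exists_mem_eroded hM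
    exact ⟨z, notMem_island_of_mem_eroded hz, hz'⟩
  · change (gate a σ (n + 8)).1 = _
    rw [gate]
    ext <;> simp [gateFrame, frame] <;> ring
  · change (gate a σ (n + 8)).2 = _
    rw [gate]
    ext <;> simp

theorem goodGate (ha : ∀ i, 1 ≤ i → 2 < a i) (n : ℕ) : GoodGate a σ (n + 1) := by
  induction n using Nat.strong_induction_on with
  | _ n ih =>
    match n, ih with
    | 0, _ => exact goodGate_one ha
    | 1, _ => exact goodGate_two ha
    | 2, _ => exact goodGate_three ha
    | 3, _ => exact goodGate_four ha
    | 4, _ => exact goodGate_five ha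
    | 5, _ => exact goodGate_six ha
    | 6, _ => exact goodGate_seven ha
    | n + 7, ih =>
      exact goodGate_add_eight ha (ih (n + 3) (by omega)) (ih (n + 4) (by omega))
        (ih (n + 5) (by omega)) (ih (n + 6) (by omega))

end Gates

/-! ### The islands are strips -/

lemma isStrip_unitSquare : IsStrip unitSquare 1 1 := by
  have hne : (unitSquareᶜ).Nonempty := ⟨(0, 0), fun h => h.1.1.ne rfl⟩
  have ho : IsOpen unitSquare := isOpen_Ioo.prod isOpen_Ioo
  have hle : ∀ x ∈ unitSquare, depth unitSquare x ≤ x.1 ∧ depth unitSquare x ≤ 1 - x.1 ∧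
      depth unitSquare x ≤ x.2 ∧ depth unitSquare x ≤ 1 - x.2 := by
    rintro ⟨s, r⟩ ⟨⟨h1, h2⟩, h3, h4⟩
    dsimp only at h1 h2 h3 h4 ⊢
    refine ⟨(depth_le_dist (z := (0, r)) fun h => h.1.1.ne rfl).trans ?_,
      (depth_le_dist (z := (1, r)) fun h => h.1.2.ne rfl).trans ?_,
      (depth_le_dist (z := (s, 0)) fun h => h.2.1.ne rfl).trans ?_,
      (depth_le_dist (z := (s, 1)) fun h => h.2.2.ne rfl).trans ?_⟩ <;>
    rw [prod_dist_le] <;> dsimp only <;> simp only [abs_le] <;> constructor <;> constructor <;>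
      linarith
  have hge : ∀ (x : ℝ × ℝ) (ρ : ℝ), ρ ≤ x.1 → ρ ≤ 1 - x.1 → ρ ≤ x.2 → ρ ≤ 1 - x.2 →
      ρ ≤ depth unitSquare x := by
    intro x ρ h1 h2 h3 h4
    refine (le_depth_iff hne).2 fun y hy => ?_
    rw [mem_ball, prod_dist_lt, abs_lt, abs_lt] at hy
    exact ⟨⟨by linarith, by linarith⟩, by linarith, by linarith⟩
  refine ⟨ho, hne, fun x hx => ⟨(1 / 2, 1 / 2), ?_, hge _ _ ?_ ?_ ?_ ?_⟩, fun s hs _ => ?_⟩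
  · obtain ⟨h1, h2, h3, h4⟩ := hle x hx
    rw [prod_dist_le, abs_le, abs_le]
    dsimp only
    exact ⟨⟨by linarith, by linarith⟩, by linarith, by linarith⟩
  iterate 4 norm_num
  · have : {x | s < depth unitSquare x} = Ioo s (1 - s) ×ˢ Ioo s (1 - s) := by
      ext x
      constructor
      · intro (hx : s < depth unitSquare x)
        obtain ⟨h1, h2, h3, h4⟩ := hle x ((depth_pos_iff hne ho).1 (hs.trans_lt hx))
        exact ⟨⟨by linarith, by linarith⟩, by linarith, by linarith⟩
      · rintro ⟨⟨h1, h2⟩, h3, h4⟩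
        refine lt_of_lt_of_le (b := min (min x.1 (1 - x.1)) (min x.2 (1 - x.2)))
          (lt_min (lt_min h1 (by linarith)) (lt_min h3 (by linarith))) (hge _ _ ?_ ?_ ?_ ?_)
        · exact (min_le_left _ _).trans (min_le_left _ _)
        · exact (min_le_left _ _).trans (min_le_right _ _)
        · exact (min_le_right _ _).trans (min_le_left _ _)
        · exact (min_le_right _ _).trans (min_le_right _ _)
    rw [this, Measure.volume_eq_prod, Measure.prod_prod, Real.volume_Ioo,
      ← ENNReal.ofReal_mul (by linarith)]
    congr 1
    ring

section Islands

variable {a : ℕ → ℝ} {σ : ℕ → Bool}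

/-- The length of the island after day `n`. -/
noncomputable def len (a : ℕ → ℝ) : ℕ → ℝ
  | 0 => 1
  | n + 1 => 2 * len a n + 2 * (t a n - 2 * t a (n + 1)) - mouthWidth a (n + 1)

lemma t_le_pow (ha : ∀ i, 1 ≤ i → 2 < a i) (n : ℕ) : t a n ≤ (1 / 2) ^ n := by
  induction n with
  | zero => simp [t_zero]
  | succ n ih =>
    have := two_mul_t_succ_lt ha n
    rw [pow_succ]
    linarith

lemma t_le_one (ha : ∀ i, 1 ≤ i → 2 < a i) (n : ℕ) : t a n ≤ 1 :=
  (t_le_pow ha n).trans (pow_le_one₀ (by norm_num) (by norm_num))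

lemma two_pow_le_len (ha : ∀ i, 1 ≤ i → 2 < a i) (n : ℕ) : 2 ^ n ≤ len a n := by
  induction n with
  | zero => simp [len]
  | succ n ih =>
    have h1 := mouthWidth_le (a := a) (n + 1)
    have h2 := two_mul_t_succ_lt ha n
    rw [w_succ ha] at h1
    rw [len, pow_succ]
    linarith

/-- A day adds at most 2 to the doubled length, so the length plus 2 at most doubles, starting from
3. -/
lemma len_le (ha : ∀ i, 1 ≤ i → 2 < a i) (n : ℕ) : len a n ≤ 3 * 2 ^ n - 2 := by
  induction n with
  | zero => simp [len]; norm_num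
  | succ n ih =>
    have h1 := mouthWidth_succ_pos ha n
    have h2 := t_le_one ha n
    have h3 := t_pos ha (n + 1)
    rw [len, pow_succ]
    linarith

lemma one_le_len (ha : ∀ i, 1 ≤ i → 2 < a i) (n : ℕ) : 1 ≤ len a n :=
  (one_le_pow₀ (by norm_num)).trans (two_pow_le_len ha n)

lemma eroded_eq (n : ℕ) : eroded a σ (n + 1) = {x | t a (n + 1) ≤ depth (island a σ n) x} := by
  ext x
  exact (le_depth_iff (nonempty_compl_island n)).symm

lemma island_succ_eq_dug (n : ℕ) : island a σ (n + 1) =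
    dug (island a σ n) (t a (n + 1)) (mouthWidth a (n + 1)) (gateFrame a σ (n + 1)) := by
  rw [island_succ, canal_eq, eroded_eq, mouth_eq, dug]

theorem isStrip_island (ha : ∀ i, 1 ≤ i → 2 < a i) (n : ℕ) :
    IsStrip (island a σ n) (t a n) (len a n) := by
  induction n with
  | zero => rw [t_zero]; exact isStrip_unitSquare
  | succ n ih =>
    have hg := goodGate (σ := σ) ha n
    rw [island_succ_eq_dug, len]
    exact ih.dug (φ := hg.isAxis.equiv (gate a σ (n + 1)).1) (t_pos ha _) (two_mul_t_succ_lt ha n)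
      (mouthWidth_succ_pos ha n).le ((t_le_one ha n).trans (one_le_len ha n)) hg.isGate

lemma isClosed_canal (ha : ∀ i, 1 ≤ i → 2 < a i) (n : ℕ) : IsClosed (canal a σ (n + 1)) := by
  rw [canal_eq, eroded_eq, mouth_eq]
  exact (isClosed_le continuous_const continuous_depth).union
    (isClosed_mouthRect _ _ ((goodGate ha n).isAxis.equiv (gate a σ (n + 1)).1))

/-! ### Canals of different colours -/

/-- Only the starting side of a mouth can lie outside the current island. The index n - 2 is three
days before day n + 1. -/
lemma mem_island_or_of_mem_mouth (ha : ∀ i, 1 ≤ i → 2 < a i) {n : ℕ} {x : ℝ × ℝ}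
    (hx : x ∈ mouth a σ (n + 1)) :
    x ∈ island a σ n ∨ (n < 3 ∧ x.1 = 0) ∨ (3 ≤ n ∧ x ∈ eroded a σ (n - 2)) := by
  have hg := goodGate (σ := σ) ha n
  have ht := t_succ_lt ha n
  have ht' := t_pos ha (n + 1)
  rw [mouth_eq] at hx
  obtain ⟨⟨s, r⟩, ⟨⟨h1, h2⟩, h3⟩, rfl⟩ := hx
  replace h3 := abs_le.2 h3
  dsimp only at h1 h2 h3
  rcases h1.eq_or_lt with rfl | h1
  · right
    rcases lt_or_ge n 3 with hn | hn
    · refine Or.inl ⟨hn, ?_⟩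
      interval_cases n <;> simp [gateFrame, gate, frame]
    · exact Or.inr ⟨hn, hg.face (by omega) r h3⟩
  · exact Or.inl (hg.isGate.mem s r h1 (h2.trans_lt ht) (by linarith))

lemma mem_unitSquare_or_of_mem_canal (ha : ∀ i, 1 ≤ i → 2 < a i) {n : ℕ} {x : ℝ × ℝ}
    (hx : x ∈ canal a σ (n + 1)) : x ∈ unitSquare ∨ x.1 = 0 := by
  rw [canal_eq] at hx
  rcases hx with hx | hx
  · exact Or.inl (island_subset_unitSquare _ (eroded_succ_subset ha _ hx))
  · rcases mem_island_or_of_mem_mouth ha hx with h | ⟨-, h⟩ | ⟨hn, h⟩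
    · exact Or.inl (island_subset_unitSquare _ h)
    · exact Or.inr h
    · obtain ⟨k, rfl⟩ : ∃ k, n = k + 3 := ⟨n - 3, by omega⟩
      exact Or.inl (island_subset_unitSquare _ (eroded_succ_subset ha _ h))

lemma notMem_island_of_mem_canal {n : ℕ} {x : ℝ × ℝ} (hx : x ∈ canal a σ (n + 1)) :
    x ∉ island a σ (n + 1) := fun h => h.2 hx

/-- A point of an older canal has left the island, so it can belong to a later canal only on the
starting side of its mouth, hence also to the canal of three days before; descend along the later
index. -/
lemma mod_three_eq_of_mem_canal (ha : ∀ i, 1 ≤ i → 2 < a i) {x : ℝ × ℝ} (hx : x ∈ unitSquare)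
    (j i : ℕ) (hij : i < j) (hi : x ∈ canal a σ (i + 1)) (hj : x ∈ canal a σ (j + 1)) :
    i % 3 = j % 3 := by
  induction j using Nat.strong_induction_on generalizing i with
  | _ j ih =>
    have hn : x ∉ island a σ j := fun h => notMem_island_of_mem_canal hi (island_antitone hij h)
    rw [canal_eq] at hj
    rcases hj with hj | hj
    · exact absurd (eroded_succ_subset ha _ hj) hn
    rcases mem_island_or_of_mem_mouth ha hj with h | ⟨-, h⟩ | ⟨h3, h⟩
    · exact absurd h hn
    · exact absurd h hx.1.1.ne'
    · obtain ⟨k, rfl⟩ : ∃ k, j = k + 3 := ⟨j - 3, by omega⟩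
      change x ∈ eroded a σ (k + 1) at h
      rcases lt_trichotomy i k with hik | rfl | hik
      · exact absurd (island_antitone hik (eroded_succ_subset ha _ h))
          (notMem_island_of_mem_canal hi)
      · omega
      · have := ih i (by omega) k hik (Or.inl h) hi
        omega

lemma exists_mem_canal {n : ℕ} {x : ℝ × ℝ} (hx : x ∈ unitSquare) (hn : x ∉ island a σ n) :
    ∃ i < n, x ∈ canal a σ (i + 1) := by
  induction n with
  | zero => exact absurd hx hn
  | succ n ih =>
    by_cases h : x ∈ island a σ n
    · exact ⟨n, n.lt_succ_self, by_contra fun hc => hn ⟨h, hc⟩⟩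
    · obtain ⟨i, hi, hx⟩ := ih h
      exact ⟨i, hi.trans n.lt_succ_self, hx⟩

/-! ### The lakes -/

lemma isOpen_lake (c : ℕ) : IsOpen (lake a σ c) := isOpen_iUnion fun _ => isOpen_interior

lemma exists_mem_canal_of_mem_lake {c : ℕ} {x : ℝ × ℝ} (hx : x ∈ lake a σ c) :
    ∃ j, x ∈ canal a σ (3 * j + c) := by
  obtain ⟨k, hk⟩ := mem_iUnion.1 hx
  obtain ⟨j, -, hj⟩ := mem_iUnion₂.1 (interior_subset hk)
  exact ⟨j, hj⟩

lemma lake_subset_unitSquare (ha : ∀ i, 1 ≤ i → 2 < a i) (c : ℕ) :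
    lake a σ (c + 1) ⊆ unitSquare := by
  intro x hx
  have hall : ∀ y ∈ lake a σ (c + 1), y ∈ unitSquare ∨ y.1 = 0 := fun y hy => by
    obtain ⟨j, hj⟩ := exists_mem_canal_of_mem_lake hy
    exact mem_unitSquare_or_of_mem_canal (n := 3 * j + c) ha hj
  refine (hall x hx).resolve_right fun h0 => ?_
  obtain ⟨δ, hδ, hball⟩ := Metric.isOpen_iff.1 (isOpen_lake (c + 1)) x hx
  -- A lake is open, so a lake point on the left side would force lake points with negative first
  -- coordinate.
  have hy : (x.1 - δ / 2, x.2) ∈ ball x δ := by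
    rw [mem_ball, prod_dist_lt]
    constructor
    · dsimp only
      rw [abs_lt]
      constructor <;> linarith
    · simpa using hδ
  rcases hall _ (hball hy) with h | h
  · have := h.1.1
    dsimp only at this
    linarith
  · dsimp only at h
    linarith

lemma eq_of_mem_lake (ha : ∀ i, 1 ≤ i → 2 < a i) {c d : ℕ} (hc : c < 3) (hd : d < 3) {x : ℝ × ℝ}
    (hxc : x ∈ lake a σ (c + 1)) (hxd : x ∈ lake a σ (d + 1)) : c = d := by
  have hx := lake_subset_unitSquare ha c hxc
  obtain ⟨i, hi⟩ := exists_mem_canal_of_mem_lake hxc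
  obtain ⟨j, hj⟩ := exists_mem_canal_of_mem_lake hxd
  rcases lt_trichotomy (3 * i + c) (3 * j + d) with h | h | h
  · have := mod_three_eq_of_mem_canal ha hx _ _ h hi hj
    omega
  · omega
  · have := mod_three_eq_of_mem_canal ha hx _ _ h hj hi
    omega

/-- The complement of the lakes in the open unit square. -/
def shore (a : ℕ → ℝ) (σ : ℕ → Bool) : Set (ℝ × ℝ) :=
  {x | x ∈ unitSquare ∧ ∀ c < 3, x ∉ lake a σ (c + 1)}

lemma canal_subset_of_mod_eq {n i j : ℕ} (hi : i < n) (h : i % 3 = j % 3) :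
    canal a σ (i + 1) ⊆ ⋃ k ∈ Finset.range (n + 1), canal a σ (3 * k + (j % 3 + 1)) := by
  refine Set.subset_biUnion_of_mem (u := fun k => canal a σ (3 * k + (j % 3 + 1)))
    (x := i / 3) (Finset.mem_coe.2 (Finset.mem_range.2 (by omega))) |>.trans' ?_
  rw [← h, show 3 * (i / 3) + (i % 3 + 1) = i + 1 by omega]

/-- Off the closure of the island, the square is locally covered by finitely many closed canals.
Those through the point share one colour and the others stay away, so the point is interior to that
lake. -/
lemma shore_subset_closure_island (ha : ∀ i, 1 ≤ i → 2 < a i) (n : ℕ) :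
    shore a σ ⊆ closure (island a σ n) := by
  rintro x ⟨hx, hV⟩
  by_contra hcl
  obtain ⟨j, hj, hxj⟩ := exists_mem_canal hx fun h => hcl (subset_closure h)
  refine hV (j % 3) (Nat.mod_lt _ (by norm_num)) (mem_iUnion.2 ⟨n, ?_⟩)
  rw [lakeOnDay, mem_interior]
  refine ⟨(unitSquare ∩ (closure (island a σ n))ᶜ) ∩
    (⋃ i ∈ {i | i < n ∧ i % 3 ≠ j % 3}, canal a σ (i + 1))ᶜ, ?_, ?_, ⟨hx, hcl⟩, ?_⟩
  · rintro y ⟨⟨hy, hycl⟩, hyV⟩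
    obtain ⟨i, hi, hyi⟩ := exists_mem_canal hy fun h => hycl (subset_closure h)
    refine canal_subset_of_mod_eq hi ?_ hyi
    by_contra hne
    exact hyV (mem_iUnion₂.2 ⟨i, ⟨hi, hne⟩, hyi⟩)
  · refine (isStrip_unitSquare.isOpen.inter isClosed_closure.isOpen_compl).inter
      (Set.Finite.isClosed_biUnion ?_ fun i _ => isClosed_canal ha i).isOpen_compl
    exact (Set.finite_lt_nat n).subset fun i hi => hi.1
  · intro h
    obtain ⟨i, ⟨hi, hne⟩, hxi⟩ := mem_iUnion₂.1 h
    rcases lt_trichotomy i j with hij | rfl | hij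
    · exact hne (mod_three_eq_of_mem_canal ha hx _ _ hij hxi hxj)
    · exact hne rfl
    · exact hne (mod_three_eq_of_mem_canal ha hx _ _ hij hxj hxi).symm

/-- Every point of the island is close to the next canal. -/
lemma exists_mem_lake_dist_le (ha : ∀ i, 1 ≤ i → 2 < a i) {n : ℕ} {x : ℝ × ℝ}
    (hx : x ∈ island a σ n) : ∃ z ∈ lake a σ (n % 3 + 1), dist x z ≤ t a n / 2 := by
  obtain ⟨z, hz1, hz2⟩ := (isStrip_island ha n).exists_le_depth x hx
  have h0 := depth_nonneg (I := island a σ n) (x := x)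
  have h1 := two_mul_t_succ_lt ha n
  refine ⟨z, mem_iUnion.2 ⟨n, ?_⟩, by linarith⟩
  rw [lakeOnDay, mem_interior]
  refine ⟨{y | t a (n + 1) < depth (island a σ n) y}, fun y hy => ?_,
    isOpen_lt continuous_const continuous_depth, show t a (n + 1) < _ by linarith⟩
  have hyc : y ∈ canal a σ (n + 1) := by
    rw [canal_eq, eroded_eq]
    exact Or.inl (show t a (n + 1) ≤ _ from le_of_lt hy)
  refine mem_iUnion₂.2 ⟨n / 3, Finset.mem_range.2 (by omega), ?_⟩
  rwa [show 3 * (n / 3) + (n % 3 + 1) = n + 1 by omega]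

lemma exists_t_lt (ha : ∀ i, 1 ≤ i → 2 < a i) {ε : ℝ} (hε : 0 < ε) :
    ∃ N, ∀ n, N ≤ n → t a n < ε := by
  obtain ⟨N, hN⟩ := exists_pow_lt_of_lt_one hε (by norm_num : (1 / 2 : ℝ) < 1)
  refine ⟨N, fun n hn => (t_le_pow ha n).trans_lt (lt_of_le_of_lt ?_ hN)⟩
  exact pow_le_pow_of_le_one (by norm_num) (by norm_num) hn

theorem inter_frontier_lake (ha : ∀ i, 1 ≤ i → 2 < a i) {c : ℕ} (hc : c < 3) :
    unitSquare ∩ frontier (lake a σ (c + 1)) = shore a σ := by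
  rw [(isOpen_lake (c + 1)).frontier_eq]
  ext x
  constructor
  · rintro ⟨hx, hcl, hn⟩
    refine ⟨hx, fun d hd hxd => ?_⟩
    obtain ⟨y, hy, hyc⟩ := mem_closure_iff.1 hcl _ (isOpen_lake (d + 1)) hxd
    obtain rfl := eq_of_mem_lake ha hc hd hyc hy
    exact hn hxd
  · intro hx
    refine ⟨hx.1, Metric.mem_closure_iff.2 fun ε hε => ?_, hx.2 c hc⟩
    obtain ⟨N, hN⟩ := exists_t_lt ha hε
    obtain ⟨y, hy, hxy⟩ := Metric.mem_closure_iff.1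
      (shore_subset_closure_island ha (3 * N + c) hx) (ε / 2) (by linarith)
    obtain ⟨z, hz, hyz⟩ := exists_mem_lake_dist_le ha hy
    -- After day 3N + c the next canal has the colour of the lake under consideration.
    rw [show (3 * N + c) % 3 = c by omega] at hz
    refine ⟨z, hz, ?_⟩
    have := dist_triangle x y z
    have := hN (3 * N + c) (by omega)
    linarith

theorem W_eq_shore (ha : ∀ i, 1 ≤ i → 2 < a i) : W a σ = shore a σ :=
  inter_frontier_lake ha (by norm_num)

/-! ### The islands are close to the shore -/

lemma exists_mem_island_of_mem_mouth (ha : ∀ i, 1 ≤ i → 2 < a i) {n : ℕ} {x : ℝ × ℝ}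
    (hx : x ∈ mouth a σ (n + 1)) : ∃ y ∈ island a σ (n + 1), dist x y ≤ t a n := by
  have hg := goodGate (σ := σ) ha n
  have ht := t_pos ha (n + 1)
  have ht' := two_mul_t_succ_lt ha n
  have hm := mouthWidth_le (a := a) (n + 1)
  rw [w_succ ha] at hm
  refine ⟨_, hg.mem_island ha (s := t a (n + 1) / 2) (ρ := t a (n + 1) / 2) (ε := 1) (by simp)
    (by linarith) (by linarith) (by linarith) (by linarith), ?_⟩
  rw [mouth_eq] at hx
  obtain ⟨⟨s, r⟩, ⟨⟨h1, h2⟩, h3, h4⟩, rfl⟩ := hx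
  dsimp only at h1 h2 h3 h4
  rw [gateFrame, hg.isAxis.dist_frame, prod_dist_le, abs_le, abs_le]
  dsimp only
  exact ⟨⟨by linarith, by linarith⟩, by linarith, by linarith⟩

/-- Moving outwards leaves the canal; if that ends in the mouth, stepping beside the mouth costs at
most another t n. -/
lemma exists_mem_island_succ (ha : ∀ i, 1 ≤ i → 2 < a i) {n : ℕ} {x : ℝ × ℝ}
    (hx : x ∈ island a σ n) : ∃ y ∈ island a σ (n + 1), dist x y ≤ 2 * t a n := by
  have hI := isStrip_island (σ := σ) ha n
  have ht := t_pos ha (n + 1)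
  have ht' := two_mul_t_succ_lt ha n
  have hd := hI.depth_le (t_pos ha n) x
  have hd0 := depth_nonneg (I := island a σ n) (x := x)
  obtain ⟨y, hxy, hy0, hy1⟩ : ∃ y, dist x y ≤ t a n / 2 ∧ 0 < depth (island a σ n) y ∧
      depth (island a σ n) y < t a (n + 1) := by
    rcases lt_or_ge (depth (island a σ n) x) (t a (n + 1)) with h | h
    · refine ⟨x, ?_, (depth_pos_iff hI.nonempty_compl hI.isOpen).2 hx, h⟩
      rw [dist_self]
      linarith
    · obtain ⟨y, hy1, hy2⟩ := exists_depth_eq_of_le_depth hI.nonempty_compl hI.isOpen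
        (x := x) (τ := t a (n + 1) / 2) (by linarith) (by linarith)
      exact ⟨y, by linarith, by linarith, by linarith⟩
  by_cases hyM : y ∈ mouth a σ (n + 1)
  · obtain ⟨z, hz, hyz⟩ := exists_mem_island_of_mem_mouth ha hyM
    refine ⟨z, hz, ?_⟩
    have := dist_triangle x y z
    linarith
  · refine ⟨y, mem_island_succ.2 ⟨(depth_pos_iff hI.nonempty_compl hI.isOpen).1 hy0, ?_, hyM⟩,
      by linarith⟩
    rw [eroded_eq]
    exact fun h : t a (n + 1) ≤ _ => by linarith

/-- The canals of days n+1 and n+2 have different colours and both come near the point. A segment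
joining them inside the convex square is connected, so disjoint open lakes cannot cover it. -/
theorem exists_mem_shore_dist_le (ha : ∀ i, 1 ≤ i → 2 < a i) {n : ℕ} {x : ℝ × ℝ}
    (hx : x ∈ island a σ n) : ∃ z ∈ shore a σ, dist x z ≤ 3 * t a n := by
  obtain ⟨y, hy, hxy⟩ := exists_mem_island_succ ha hx
  obtain ⟨z₁, hz₁, hxz₁⟩ := exists_mem_lake_dist_le ha hx
  obtain ⟨z₂, hz₂, hyz₂⟩ := exists_mem_lake_dist_le ha hy
  have ht := t_pos ha n
  have ht' := t_succ_lt ha n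
  have htri := dist_triangle x y z₂
  have hconv : Convex ℝ unitSquare := (convex_Ioo 0 1).prod (convex_Ioo 0 1)
  have hsq : segment ℝ z₁ z₂ ⊆ unitSquare :=
    hconv.segment_subset (lake_subset_unitSquare ha _ hz₁) (lake_subset_unitSquare ha _ hz₂)
  have hball : segment ℝ z₁ z₂ ⊆ closedBall x (3 * t a n) :=
    (convex_closedBall x _).segment_subset (by rw [mem_closedBall']; linarith)
      (by rw [mem_closedBall']; linarith)
  by_contra! hno
  have hcov : segment ℝ z₁ z₂ ⊆ lake a σ (n % 3 + 1) ∪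
      ⋃ c ∈ {c | c < 3 ∧ c ≠ n % 3}, lake a σ (c + 1) := by
    intro z hz
    have hzs : z ∉ shore a σ := fun h => (hno z h).not_ge (mem_closedBall'.1 (hball hz))
    simp only [shore, mem_ofPred_eq, not_and, not_forall, not_not] at hzs
    obtain ⟨c, hc, hzc⟩ := hzs (hsq hz)
    by_cases hcn : c = n % 3
    · exact Or.inl (hcn ▸ hzc)
    · exact Or.inr (mem_iUnion₂.2 ⟨c, ⟨hc, hcn⟩, hzc⟩)
  obtain ⟨z, -, hz, hz'⟩ := (convex_segment z₁ z₂).isPreconnected _ _ (isOpen_lake _)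
    (isOpen_biUnion fun c _ => isOpen_lake _) hcov ⟨z₁, left_mem_segment ℝ _ _, hz₁⟩
    ⟨z₂, right_mem_segment ℝ _ _,
      mem_iUnion₂.2 ⟨(n + 1) % 3, ⟨Nat.mod_lt _ (by norm_num), by omega⟩, hz₂⟩⟩
  obtain ⟨c, ⟨hc, hcn⟩, hzc⟩ := mem_iUnion₂.1 hz'
  exact hcn (eq_of_mem_lake ha hc (Nat.mod_lt _ (by norm_num)) hzc hz)

end Islands

/-! ### Areas -/

lemma volume_ball_prod (x : ℝ × ℝ) {r : ℝ} (hr : 0 ≤ r) :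
    volume (ball x r) = ENNReal.ofReal ((2 * r) ^ 2) := by
  rw [← ball_prod_same, Measure.volume_eq_prod, Measure.prod_prod, Real.volume_ball,
    Real.volume_ball, ← ENNReal.ofReal_mul (by linarith), sq]

lemma volume_closedBall_prod (x : ℝ × ℝ) {r : ℝ} (hr : 0 ≤ r) :
    volume (closedBall x r) = ENNReal.ofReal ((2 * r) ^ 2) := by
  rw [← closedBall_prod_same, Measure.volume_eq_prod, Measure.prod_prod, Real.volume_closedBall,
    Real.volume_closedBall, ← ENNReal.ofReal_mul (by linarith), sq]

namespace IsStrip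

variable {I : Set (ℝ × ℝ)} {t l s : ℝ}

lemma volume_depth_mem_Ioo (h : IsStrip I t l) (htl : t ≤ l) (hs : 0 < s) (hs' : s < t / 2) :
    volume {x | 0 < depth I x ∧ depth I x < s} =
      ENNReal.ofReal (2 * s * (l + t) - 4 * s ^ 2) := by
  have heq : {x | 0 < depth I x ∧ depth I x < s} =
      {x | 0 < depth I x} \ {x | s ≤ depth I x} := by
    ext x
    simp
  have hv := h.volume_le_depth hs hs'
  have hsub : {x | s ≤ depth I x} ⊆ {x | 0 < depth I x} :=
    fun x (hx : s ≤ depth I x) => hs.trans_le hx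
  rw [heq, measure_sdiff hsub
    (isClosed_le continuous_const continuous_depth).measurableSet.nullMeasurableSet
    (by rw [hv]; exact ENNReal.ofReal_ne_top), hv, h.volume_lt_depth 0 le_rfl (by linarith),
    ← ENNReal.ofReal_sub _ (mul_nonneg (by linarith) (by linarith))]
  congr 1
  ring

lemma volume_depth_mem_Ioo_le (h : IsStrip I t l) (ht : 0 < t) (htl : t ≤ l) (hs : 0 < s) :
    volume {x | 0 < depth I x ∧ depth I x < s} ≤ ENNReal.ofReal (2 * s * (l + t)) := by
  rcases lt_or_ge s (t / 2) with hs' | hs'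
  · rw [h.volume_depth_mem_Ioo htl hs hs']
    exact ENNReal.ofReal_le_ofReal (by nlinarith)
  · refine (measure_mono fun x (hx : 0 < depth I x ∧ _) => hx.1).trans
      ((h.volume_lt_depth 0 le_rfl (by linarith)).trans_le (ENNReal.ofReal_le_ofReal ?_))
    nlinarith

end IsStrip

section Counting

variable {a : ℕ → ℝ} {σ : ℕ → Bool} {n : ℕ} {ε : ℝ}

lemma t_le_len (ha : ∀ i, 1 ≤ i → 2 < a i) (n : ℕ) : t a n ≤ len a n :=
  (t_le_one ha n).trans (one_le_len ha n)

/-! ### The upper bound -/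

/-- The shore is in the closure of island n+1, where the depth in island n is below t (n+1) ≤ 2ε. A
small inward push makes room for a whole ball in the collar. -/
lemma exists_ball_subset (ha : ∀ i, 1 ≤ i → 2 < a i) (h1 : t a (n + 1) / 2 ≤ ε)
    (h2 : ε < t a n / 2) {x : ℝ × ℝ} (hx : x ∈ shore a σ) :
    ∃ y, dist x y ≤ ε / 8 ∧
      ball y (ε / 16) ⊆ {x | 0 < depth (island a σ n) x ∧ depth (island a σ n) x < 3 * ε} := by
  have hI := isStrip_island (σ := σ) ha n
  have ht := t_pos ha (n + 1)
  obtain ⟨z, hz, hxz⟩ := Metric.mem_closure_iff.1 (shore_subset_closure_island ha (n + 1) hx)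
    (ε / 16) (by linarith)
  have hz' : depth (island a σ n) z < t a (n + 1) := by
    have := (mem_island_succ.1 hz).2.1
    rw [eroded_eq] at this
    exact lt_of_not_ge this
  obtain ⟨y, hzy, hy⟩ : ∃ y, dist z y ≤ ε / 16 ∧ ε / 16 ≤ depth (island a σ n) y := by
    rcases le_total (depth (island a σ n) z) (ε / 16) with h | h
    · obtain ⟨y, hy1, hy2⟩ := hI.exists_depth_eq (island_succ_subset n hz) h (by linarith)
      have := depth_nonneg (I := island a σ n) (x := z)
      exact ⟨y, by linarith, hy2.ge⟩
    · exact ⟨z, by rw [dist_self]; linarith, h⟩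
  have hd := depth_le_depth_add_dist (I := island a σ n) (x := y) (y := z)
  rw [dist_comm] at hd
  refine ⟨y, ?_, fun v hv => ?_⟩
  · have := dist_triangle x z y
    linarith
  · rw [mem_ball'] at hv
    have h3 := depth_le_depth_add_dist (I := island a σ n) (x := y) (y := v)
    have h4 := depth_le_depth_add_dist (I := island a σ n) (x := v) (y := y)
    rw [dist_comm] at h4
    exact ⟨by linarith, by linarith⟩

/-- Separated shore points give disjoint squares of side ε/8 in a collar of area at most 6ε · 3 ·
2^n; and 1152 = 64 · 18. -/
lemma card_mul_sq_le (ha : ∀ i, 1 ≤ i → 2 < a i) (h1 : t a (n + 1) / 2 ≤ ε)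
    (h2 : ε < t a n / 2) {F : Finset (ℝ × ℝ)} (hF : (F : Set (ℝ × ℝ)) ⊆ shore a σ)
    (hsep : ∀ x ∈ F, ∀ y ∈ F, x ≠ y → ε / 2 < dist x y) :
    (F.card : ℝ) ≤ 1152 * 2 ^ n / ε := by
  have hε : 0 < ε := lt_of_lt_of_le (by have := t_pos ha (n + 1); linarith) h1
  have hex : ∀ x : ℝ × ℝ, ∃ y, x ∈ F → dist x y ≤ ε / 8 ∧
      ball y (ε / 16) ⊆ {x | 0 < depth (island a σ n) x ∧ depth (island a σ n) x < 3 * ε} := by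
    intro x
    by_cases hx : x ∈ F
    · obtain ⟨y, hy⟩ := exists_ball_subset ha h1 h2 (hF hx)
      exact ⟨y, fun _ => hy⟩
    · exact ⟨0, fun h => absurd h hx⟩
  choose f hf using hex
  have hdisj : (F : Set (ℝ × ℝ)).PairwiseDisjoint fun x => ball (f x) (ε / 16) := by
    intro x hx y hy hxy
    refine ball_disjoint_ball ?_
    have h3 := hsep x hx y hy hxy
    have h4 := (hf x hx).1
    have h5 := (hf y hy).1
    have h6 := dist_triangle4 x (f x) (f y) y
    rw [dist_comm (f y)] at h6
    linarith
  have hvol := measure_biUnion_finset (μ := volume) hdisj fun _ _ => measurableSet_ball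
  have hle : volume (⋃ x ∈ F, ball (f x) (ε / 16)) ≤
      ENNReal.ofReal (2 * (3 * ε) * (len a n + t a n)) :=
    (measure_mono (iUnion₂_subset fun x hx => (hf x hx).2)).trans
      ((isStrip_island ha n).volume_depth_mem_Ioo_le (t_pos ha n) (t_le_len ha n) (by linarith))
  simp only [hvol, volume_ball_prod _ (by linarith : (0 : ℝ) ≤ ε / 16), Finset.sum_const, nsmul_eq_mul] at hle
  rw [← ENNReal.ofReal_natCast, ← ENNReal.ofReal_mul (by positivity),
    ENNReal.ofReal_le_ofReal_iff (by
      have := t_pos ha n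
      have := one_le_len ha n
      positivity)] at hle
  have hlen := len_le ha n
  have ht := t_le_one ha n
  rw [le_div_iff₀ hε]
  have h7 : (F.card : ℝ) * ε * (ε / 64) ≤ 1152 * 2 ^ n * (ε / 64) := by
    nlinarith
  exact le_of_mul_le_mul_right h7 (by positivity)

lemma externalCoveringNumber_le (ha : ∀ i, 1 ≤ i → 2 < a i) (h1 : t a (n + 1) / 2 ≤ ε)
    (h2 : ε < t a n / 2) :
    externalCoveringNumber (Real.toNNReal (ε / 2)) (shore a σ) ≤
      (⌊1152 * 2 ^ n / ε⌋₊ : ℕ) := by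
  have hε : 0 < ε := lt_of_lt_of_le (by have := t_pos ha (n + 1); linarith) h1
  refine (externalCoveringNumber_le_coveringNumber _ _).trans
    ((coveringNumber_le_packingNumber _ _).trans ?_)
  refine iSup₂_le fun C hC => iSup_le fun hsep => ?_
  by_contra! hlt
  obtain ⟨F, hF, hFcard⟩ := Set.exists_subset_encard_eq (Order.add_one_le_of_lt hlt)
  have hfin : F.Finite := Set.finite_of_encard_eq_coe (k := ⌊1152 * 2 ^ n / ε⌋₊ + 1)
    (by rw [hFcard]; push_cast; rfl)
  have hcard := card_mul_sq_le ha h1 h2 (F := hfin.toFinset)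
    (by rw [hfin.coe_toFinset]; exact hF.trans hC) fun x hx y hy hxy => by
      have := hsep (hF (hfin.mem_toFinset.1 hx)) (hF (hfin.mem_toFinset.1 hy)) hxy
      change ENNReal.ofReal (ε / 2) < _ at this
      rw [edist_dist, ENNReal.ofReal_lt_ofReal_iff_of_nonneg (by linarith)] at this
      exact this
  rw [hfin.encard_eq_coe_toFinset_card] at hFcard
  have hc : hfin.toFinset.card = ⌊1152 * 2 ^ n / ε⌋₊ + 1 := by exact_mod_cast hFcard
  have := Nat.lt_floor_add_one (1152 * 2 ^ n / ε)
  rw [hc] at hcard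
  push_cast at hcard
  linarith

/-! ### The lower bound -/

/-- The neighbourhood of the mouth of the canal of day `n` of radius `ε`. -/
def mouthNhd (a : ℕ → ℝ) (σ : ℕ → Bool) (n : ℕ) (ε : ℝ) : Set (ℝ × ℝ) :=
  gateFrame a σ n '' (Icc (-ε) (t a n + ε) ×ˢ
    Icc (-(mouthWidth a n / 2 + ε)) (mouthWidth a n / 2 + ε))

lemma volume_mouthNhd_le (ha : ∀ i, 1 ≤ i → 2 < a i) (h1 : t a (n + 1) / 2 ≤ ε)
    (h2 : ε < t a n / 2) :
    volume (mouthNhd a σ (n + 1) ε) ≤ ENNReal.ofReal (8 * ε * t a n) := by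
  have ht := t_pos ha (n + 1)
  have hm := mouthWidth_le (a := a) (n + 1)
  have hm' := mouthWidth_succ_pos ha n
  rw [w_succ ha] at hm
  have := volume_image_isometryEquiv ((goodGate (σ := σ) ha n).isAxis.equiv (gate a σ (n + 1)).1)
    (Icc (-ε) (t a (n + 1) + ε) ×ˢ
      Icc (-(mouthWidth a (n + 1) / 2 + ε)) (mouthWidth a (n + 1) / 2 + ε))
  rw [IsAxis.coe_equiv, ← gateFrame] at this
  rw [mouthNhd, this, Measure.volume_eq_prod, Measure.prod_prod, Real.volume_Icc, Real.volume_Icc,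
    ← ENNReal.ofReal_mul (by linarith)]
  refine ENNReal.ofReal_le_ofReal ?_
  -- By the choice of scale, t (n+1) ≤ 2ε, and mouth width and 2ε are both at most t n.
  calc _ = (t a (n + 1) + 2 * ε) * (mouthWidth a (n + 1) + 2 * ε) := by ring
    _ ≤ (4 * ε) * (2 * t a n) := by
      apply mul_le_mul <;> linarith
    _ = _ := by ring

lemma lt_dist_of_notMem_mouthNhd (ha : ∀ i, 1 ≤ i → 2 < a i) {x y : ℝ × ℝ}
    (hx : x ∉ mouthNhd a σ (n + 1) ε) (hy : y ∈ mouth a σ (n + 1)) : ε < dist x y := by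
  by_contra! h
  refine hx ?_
  obtain ⟨s, r, rfl⟩ := (goodGate (σ := σ) ha n).isAxis.exists_frame (gate a σ (n + 1)).1 x
  rw [mouth_eq] at hy
  obtain ⟨⟨s', r'⟩, ⟨⟨h1, h2⟩, h3, h4⟩, rfl⟩ := hy
  rw [gateFrame, (goodGate (σ := σ) ha n).isAxis.dist_frame, prod_dist_le, abs_le, abs_le] at h
  dsimp only at *
  exact mem_image_of_mem _ ⟨⟨by dsimp only; linarith, by dsimp only; linarith⟩,
    by dsimp only; linarith, by dsimp only; linarith⟩

/-- A move of at most ε reaches island n+1, since the mouth is too far away to interfere; from there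
the shore is within 3 t (n+1) ≤ 6ε. -/
lemma exists_mem_shore_of_depth_lt (ha : ∀ i, 1 ≤ i → 2 < a i) (h1 : t a (n + 1) / 2 ≤ ε)
    {x : ℝ × ℝ} (hx : 0 < depth (island a σ n) x) (hx' : depth (island a σ n) x < ε)
    (hxM : x ∉ mouthNhd a σ (n + 1) ε) : ∃ z ∈ shore a σ, dist x z ≤ 7 * ε := by
  have hI := isStrip_island (σ := σ) ha n
  have ht := t_pos ha (n + 1)
  obtain ⟨y, hxy, hy0, hy1⟩ : ∃ y, dist x y ≤ ε ∧ 0 < depth (island a σ n) y ∧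
      depth (island a σ n) y < t a (n + 1) := by
    rcases lt_or_ge (depth (island a σ n) x) (t a (n + 1)) with h | h
    · exact ⟨x, by rw [dist_self]; linarith, hx, h⟩
    · obtain ⟨y, hy1, hy2⟩ := exists_depth_eq_of_le_depth hI.nonempty_compl hI.isOpen
        (x := x) (τ := t a (n + 1) / 2) (by linarith) (by linarith)
      exact ⟨y, by linarith, by linarith, by linarith⟩
  have hy : y ∈ island a σ (n + 1) := by
    refine mem_island_succ.2 ⟨(depth_pos_iff hI.nonempty_compl hI.isOpen).1 hy0, ?_,
      fun hyM => (lt_dist_of_notMem_mouthNhd ha hxM hyM).not_ge hxy⟩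
    rw [eroded_eq]
    exact fun h : t a (n + 1) ≤ _ => by linarith
  obtain ⟨z, hz, hyz⟩ := exists_mem_shore_dist_le ha hy
  refine ⟨z, hz, ?_⟩
  have := dist_triangle x y z
  linarith

/-- Enlarging each covering square from radius ε/2 to 15ε/2 covers the collar minus the mouth
neighbourhood; 225 = 15². For n ≥ 2 the losses 4ε² and 8ε t n leave area at least 2^n ε. -/
lemma le_card_of_isCover (ha : ∀ i, 1 ≤ i → 2 < a i) (hn : 2 ≤ n) (h1 : t a (n + 1) / 2 ≤ ε)
    (h2 : ε < t a n / 2) {F : Finset (ℝ × ℝ)}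
    (hF : IsCover (Real.toNNReal (ε / 2)) (shore a σ) (F : Set (ℝ × ℝ))) :
    2 ^ n / (225 * ε) ≤ (F.card : ℝ) := by
  have hε : 0 < ε := lt_of_lt_of_le (by have := t_pos ha (n + 1); linarith) h1
  have hI := isStrip_island (σ := σ) ha n
  have hsub : {x | 0 < depth (island a σ n) x ∧ depth (island a σ n) x < ε} \
      mouthNhd a σ (n + 1) ε ⊆ ⋃ c ∈ F, closedBall c (15 * ε / 2) := by
    rintro x ⟨⟨hx0, hx1⟩, hxM⟩
    obtain ⟨z, hz, hxz⟩ := exists_mem_shore_of_depth_lt ha h1 hx0 hx1 hxM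
    obtain ⟨c, hc, hzc⟩ := hF hz
    change edist z c ≤ ENNReal.ofReal (ε / 2) at hzc
    rw [edist_dist, ENNReal.ofReal_le_ofReal_iff (by linarith)] at hzc
    refine mem_iUnion₂.2 ⟨c, hc, ?_⟩
    rw [mem_closedBall]
    have := dist_triangle x z c
    linarith
  have hlen := two_pow_le_len ha n
  have hpow : (2 : ℝ) ^ 2 ≤ 2 ^ n := pow_le_pow_right₀ (by norm_num) hn
  have ht : t a n ≤ 1 / 4 := by
    refine (t_le_pow ha n).trans ?_
    calc (1 / 2 : ℝ) ^ n ≤ (1 / 2) ^ 2 := pow_le_pow_of_le_one (by norm_num) (by norm_num) hn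
      _ = 1 / 4 := by norm_num
  have hvol : ENNReal.ofReal (2 * ε * (len a n + t a n) - 4 * ε ^ 2) -
      ENNReal.ofReal (8 * ε * t a n) ≤ ENNReal.ofReal (F.card * (15 * ε) ^ 2) := by
    rw [← hI.volume_depth_mem_Ioo (t_le_len ha n) hε h2]
    refine (tsub_le_tsub_left (volume_mouthNhd_le (σ := σ) ha h1 h2) _).trans
      (le_measure_sdiff.trans ((measure_mono hsub).trans
        ((measure_biUnion_finset_le _ _).trans_eq ?_)))
    simp only [volume_closedBall_prod _ (by linarith : (0 : ℝ) ≤ 15 * ε / 2), Finset.sum_const,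
      nsmul_eq_mul]
    rw [← ENNReal.ofReal_natCast, ← ENNReal.ofReal_mul (by positivity)]
    congr 1
    ring
  have ht0 := t_pos ha n
  rw [← ENNReal.ofReal_sub _ (by positivity), ENNReal.ofReal_le_ofReal_iff (by positivity)] at hvol
  rw [div_le_iff₀ (by positivity)]
  have h3 : 2 ^ n * ε ≤ F.card * (225 * ε) * ε := by nlinarith
  exact le_of_mul_le_mul_right h3 hε

lemma le_externalCoveringNumber (ha : ∀ i, 1 ≤ i → 2 < a i) (hn : 2 ≤ n)
    (h1 : t a (n + 1) / 2 ≤ ε) (h2 : ε < t a n / 2) :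
    ((⌈2 ^ n / (225 * ε)⌉₊ : ℕ) : ℕ∞) ≤
      externalCoveringNumber (Real.toNNReal (ε / 2)) (shore a σ) := by
  refine le_iInf₂ fun C hC => ?_
  by_cases hfin : C.Finite
  · rw [hfin.encard_eq_coe_toFinset_card, Nat.cast_le, Nat.ceil_le]
    exact le_card_of_isCover ha hn h1 h2 (by rwa [hfin.coe_toFinset])
  · rw [Set.Infinite.encard_eq hfin]
    exact le_top

theorem boxCount_shore_mem_Icc (ha : ∀ i, 1 ≤ i → 2 < a i) (hn : 2 ≤ n)
    (h1 : t a (n + 1) / 2 ≤ ε) (h2 : ε < t a n / 2) :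
    (boxCount ε (shore a σ) : ℝ) ∈ Icc (2 ^ n / (225 * ε)) (1152 * 2 ^ n / ε) := by
  have hε : 0 < ε := lt_of_lt_of_le (by have := t_pos ha (n + 1); linarith) h1
  have hle := externalCoveringNumber_le (σ := σ) ha h1 h2
  have hge := le_externalCoveringNumber (σ := σ) ha hn h1 h2
  -- The upper bound makes the covering number finite, so `toNat` does not return its default 0.
  obtain ⟨N, hN⟩ := ENat.ne_top_iff_exists.1 (ne_top_of_le_ne_top (ENat.natCast_ne_top _) hle)
  rw [← hN, Nat.cast_le] at hle hge
  rw [boxCount, ← hN, ENat.toNat_natCast]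
  exact ⟨Nat.ceil_le.1 hge, (Nat.le_floor_iff (by positivity)).1 hle⟩

end Counting

/-! ### The dimension of the shore -/

section Dimension

variable {a : ℕ → ℝ} {σ : ℕ → Bool} {n : ℕ} {ε : ℝ}

lemma log_t (ha : ∀ i, 1 ≤ i → 2 < a i) (n : ℕ) :
    Real.log (t a n) = -∑ i ∈ Finset.Icc 1 n, Real.log (a i) := by
  rw [t, Real.log_prod, ← Finset.sum_neg_distrib]
  · exact Finset.sum_congr rfl fun i _ => Real.log_inv _
  · intro i hi
    have := ha i (Finset.mem_Icc.1 hi).1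
    positivity

lemma mul_log_two_le_sum_log (ha : ∀ i, 1 ≤ i → 2 < a i) (n : ℕ) :
    n * Real.log 2 ≤ ∑ i ∈ Finset.Icc 1 n, Real.log (a i) := by
  have := Finset.card_nsmul_le_sum (Finset.Icc 1 n) (fun i => Real.log (a i)) (Real.log 2)
    fun i hi => Real.log_le_log (by norm_num) (ha i (Finset.mem_Icc.1 hi).1).le
  simpa using this

/-- The level of a scale. -/
lemma exists_level (ha : ∀ i, 1 ≤ i → 2 < a i) (hε : 0 < ε) {N : ℕ} (h : ε < t a N / 2) :
    ∃ n, N ≤ n ∧ t a (n + 1) / 2 ≤ ε ∧ ε < t a n / 2 := by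
  have hex : ∃ m, t a (m + 1) / 2 ≤ ε := by
    obtain ⟨M, hM⟩ := exists_t_lt ha hε
    have := hM (M + 1) (by omega)
    exact ⟨M, by linarith⟩
  classical
  have hanti : Antitone (t a) := antitone_nat_of_succ_le fun n => (t_succ_lt ha n).le
  refine ⟨Nat.find hex, ?_, Nat.find_spec hex, ?_⟩
  · by_contra! hlt
    have h1 := Nat.find_spec hex
    have h2 := hanti (by omega : Nat.find hex + 1 ≤ N)
    linarith
  · rcases Nat.eq_zero_or_pos (Nat.find hex) with h0 | h0
    · rw [h0]
      have := hanti (Nat.zero_le N)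
      linarith
    · have h1 := Nat.find_min hex (m := Nat.find hex - 1) (by omega)
      rw [Nat.sub_add_cancel h0] at h1
      exact lt_of_not_ge h1

lemma sum_log_le_log_inv (ha : ∀ i, 1 ≤ i → 2 < a i) (hε : 0 < ε) (h2 : ε < t a n / 2) :
    ∑ i ∈ Finset.Icc 1 n, Real.log (a i) ≤ Real.log (1 / ε) := by
  have ht := t_pos ha n
  have := Real.log_le_log hε (show ε ≤ t a n by linarith)
  rw [log_t ha] at this
  rw [one_div, Real.log_inv]
  linarith

lemma log_inv_le_sum_log (ha : ∀ i, 1 ≤ i → 2 < a i) (h1 : t a (n + 1) / 2 ≤ ε) :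
    Real.log (1 / ε) ≤ ∑ i ∈ Finset.Icc 1 (n + 1), Real.log (a i) + Real.log 2 := by
  have ht := t_pos ha (n + 1)
  have := Real.log_le_log (by linarith) h1
  rw [Real.log_div ht.ne' (by norm_num), log_t ha] at this
  rw [one_div, Real.log_inv]
  linarith

lemma abs_log_boxCount_sub_le (ha : ∀ i, 1 ≤ i → 2 < a i) (hn : 2 ≤ n)
    (h1 : t a (n + 1) / 2 ≤ ε) (h2 : ε < t a n / 2) :
    |Real.log (boxCount ε (shore a σ)) - (n * Real.log 2 + Real.log (1 / ε))| ≤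
      Real.log 1152 := by
  have hε : 0 < ε := lt_of_lt_of_le (by have := t_pos ha (n + 1); linarith) h1
  obtain ⟨h3, h4⟩ := boxCount_shore_mem_Icc (σ := σ) ha hn h1 h2
  have h5 : (0 : ℝ) < 2 ^ n / (225 * ε) := by positivity
  have h6 := Real.log_le_log h5 h3
  have h7 := Real.log_le_log (h5.trans_le h3) h4
  rw [Real.log_div (by positivity) (by positivity), Real.log_mul (by norm_num) hε.ne',
    Real.log_pow] at h6
  rw [Real.log_div (by positivity) hε.ne', Real.log_mul (by norm_num) (by positivity),
    Real.log_pow] at h7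
  have h8 : Real.log 225 ≤ Real.log 1152 := Real.log_le_log (by norm_num) (by norm_num)
  rw [one_div, Real.log_inv, abs_le]
  constructor <;> linarith

/-- The quotient in the definition of the dimension is bracketed by those of two levels. -/
lemma log_boxCount_div_mem_Icc (ha : ∀ i, 1 ≤ i → 2 < a i) (hn : 2 ≤ n)
    (h1 : t a (n + 1) / 2 ≤ ε) (h2 : ε < t a n / 2) :
    Real.log (boxCount ε (shore a σ)) / Real.log (1 / ε) ∈
      Icc (1 + (n + 1 : ℕ) * Real.log 2 / ∑ i ∈ Finset.Icc 1 (n + 1), Real.log (a i) -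
          (Real.log 1152 + 2 * Real.log 2) / Real.log (1 / ε))
        (1 + n * Real.log 2 / Real.log (1 / ε) + Real.log 1152 / Real.log (1 / ε)) := by
  have hε : 0 < ε := lt_of_lt_of_le (by have := t_pos ha (n + 1); linarith) h1
  have hlog2 : 0 < Real.log 2 := Real.log_pos (by norm_num)
  have hlow := mul_log_two_le_sum_log ha n
  have hlow1 := mul_log_two_le_sum_log ha (n + 1)
  have hb1 := sum_log_le_log_inv ha hε h2
  have hb2 := log_inv_le_sum_log ha h1
  have habs := abs_le.1 (abs_log_boxCount_sub_le (σ := σ) ha hn h1 h2)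
  have hn0 : (0 : ℝ) < n := by exact_mod_cast (by omega : 0 < n)
  have hnlog : 0 < n * Real.log 2 := by positivity
  have hn1log : 0 < ((n + 1 : ℕ) : ℝ) * Real.log 2 := by positivity
  set b := Real.log (1 / ε)
  set S := ∑ i ∈ Finset.Icc 1 (n + 1), Real.log (a i)
  have hb : 0 < b := by linarith
  have hS : 0 < S := by linarith
  constructor
  -- From b ≤ S + log 2 and (n+1) log 2 ≤ S one gets (n+1) b ≤ (n+2) S, which costs the second log
  -- 2.
  · have h3 : ((n + 1 : ℕ) : ℝ) * Real.log 2 / S ≤ (n * Real.log 2 + 2 * Real.log 2) / b := by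
      rw [div_le_div_iff₀ hS hb]
      push_cast at *
      nlinarith
    rw [le_div_iff₀ hb]
    calc _ ≤ (1 + (n * Real.log 2 + 2 * Real.log 2) / b -
          (Real.log 1152 + 2 * Real.log 2) / b) * b :=
          mul_le_mul_of_nonneg_right (by linarith) hb.le
      _ = b + n * Real.log 2 - Real.log 1152 := by field_simp; ring
      _ ≤ _ := by linarith
  · rw [div_le_iff₀ hb]
    calc _ ≤ b + n * Real.log 2 + Real.log 1152 := by linarith
      _ = _ := by field_simp

lemma tendsto_log_one_div : Filter.Tendsto (fun ε : ℝ => Real.log (1 / ε))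
    (nhdsWithin 0 (Ioi 0)) Filter.atTop := by
  simp only [one_div]
  exact Real.tendsto_log_atTop.comp tendsto_inv_nhdsGT_zero

lemma hasBoxDim_shore_of_tendsto (ha : ∀ i, 1 ≤ i → 2 < a i) {L : ℝ}
    (hL : Filter.Tendsto
      (fun n : ℕ => (n : ℝ) * Real.log 2 / ∑ i ∈ Finset.Icc 1 n, Real.log (a i))
      Filter.atTop (nhds L)) : HasBoxDim (shore a σ) (1 + L) := by
  refine Metric.tendsto_nhds.2 fun δ hδ => ?_
  obtain ⟨N, hN⟩ := Metric.tendsto_atTop.1 hL (δ / 2) (by linarith)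
  have hlog2 : 0 < Real.log 2 := Real.log_pos (by norm_num)
  have hlogK : 0 < Real.log 1152 := Real.log_pos (by norm_num)
  filter_upwards [tendsto_log_one_div.eventually_gt_atTop
      ((Real.log 1152 + 2 * Real.log 2) / (δ / 2)), self_mem_nhdsWithin,
    nhdsWithin_le_nhds (Iio_mem_nhds (half_pos (t_pos ha (N + 2))))] with ε hb hε hεN
  obtain ⟨n, hn, h1, h2⟩ := exists_level ha hε hεN
  obtain ⟨h3, h4⟩ := log_boxCount_div_mem_Icc (σ := σ) ha (by omega) h1 h2
  have hb0 : 0 < Real.log (1 / ε) := lt_trans (by positivity) hb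
  have hC : (Real.log 1152 + 2 * Real.log 2) / Real.log (1 / ε) < δ / 2 := by
    rw [div_lt_iff₀ (by linarith)] at hb
    rw [div_lt_iff₀ hb0]
    linarith
  have hK : Real.log 1152 / Real.log (1 / ε) ≤
      (Real.log 1152 + 2 * Real.log 2) / Real.log (1 / ε) :=
    div_le_div_of_nonneg_right (by linarith) hb0.le
  have hS : 0 < ∑ i ∈ Finset.Icc 1 n, Real.log (a i) := by
    have hn0 : (0 : ℝ) < n := by exact_mod_cast (by omega : 0 < n)
    exact lt_of_lt_of_le (by positivity) (mul_log_two_le_sum_log ha n)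
  have hq : n * Real.log 2 / Real.log (1 / ε) ≤
      n * Real.log 2 / ∑ i ∈ Finset.Icc 1 n, Real.log (a i) :=
    div_le_div_of_nonneg_left (by positivity) hS (sum_log_le_log_inv ha hε h2)
  have h5 := hN n (by omega)
  have h6 := hN (n + 1) (by omega)
  rw [Real.dist_eq, abs_lt] at h5 h6 ⊢
  constructor <;> linarith

lemma tendsto_of_hasBoxDim_shore (ha : ∀ i, 1 ≤ i → 2 < a i) {L : ℝ}
    (hL : HasBoxDim (shore a σ) (1 + L)) : Filter.Tendsto
      (fun n : ℕ => (n : ℝ) * Real.log 2 / ∑ i ∈ Finset.Icc 1 n, Real.log (a i))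
      Filter.atTop (nhds L) := by
  have hlog2 : 0 < Real.log 2 := Real.log_pos (by norm_num)
  have hlogK : 0 < Real.log 1152 := Real.log_pos (by norm_num)
  rw [← Filter.tendsto_add_atTop_iff_nat 1]
  -- At these scales log (1/ε) equals the sum up to n+1 plus log 2, so both brackets compare with
  -- the same term n+1 of the sequence.
  have hscale : Filter.Tendsto (fun n => t a (n + 1) / 2) Filter.atTop
      (nhdsWithin 0 (Ioi 0)) := by
    refine tendsto_nhdsWithin_iff.2 ⟨Metric.tendsto_atTop.2 fun δ hδ => ?_,
      Filter.Eventually.of_forall fun n => half_pos (t_pos ha (n + 1))⟩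
    obtain ⟨N, hN⟩ := exists_t_lt ha hδ
    refine ⟨N, fun n hn => ?_⟩
    have h1 := hN (n + 1) (by omega)
    have h2 := t_pos ha (n + 1)
    rw [Real.dist_eq, sub_zero, abs_of_pos (by linarith)]
    linarith
  have hC : Filter.Tendsto (fun n => (Real.log 1152 + 2 * Real.log 2) /
      Real.log (1 / (t a (n + 1) / 2))) Filter.atTop (nhds 0) :=
    (tendsto_log_one_div.comp hscale).const_div_atTop _
  have hf := (hL.comp hscale).sub_const 1
  rw [add_sub_cancel_left] at hf
  refine tendsto_of_tendsto_of_dist hf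
    (squeeze_zero' (Filter.Eventually.of_forall fun _ => dist_nonneg) ?_ hC)
  filter_upwards [Filter.eventually_ge_atTop 2] with n hn
  have h2 : t a (n + 1) / 2 < t a n / 2 := by
    have := t_succ_lt ha n
    linarith
  obtain ⟨h3, h4⟩ := log_boxCount_div_mem_Icc (σ := σ) ha hn le_rfl h2
  have hn0 : (0 : ℝ) < n := by exact_mod_cast (by omega : 0 < n)
  have hnlog : 0 < n * Real.log 2 := by positivity
  have hlow := mul_log_two_le_sum_log ha (n + 1)
  have hS : 0 < ∑ i ∈ Finset.Icc 1 (n + 1), Real.log (a i) :=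
    lt_of_lt_of_le (by positivity) hlow
  have hb : Real.log (1 / (t a (n + 1) / 2)) =
      ∑ i ∈ Finset.Icc 1 (n + 1), Real.log (a i) + Real.log 2 := by
    rw [one_div, Real.log_inv, Real.log_div (t_pos ha _).ne' (by norm_num), log_t ha]
    ring
  have hb0 : 0 < Real.log (1 / (t a (n + 1) / 2)) := by linarith
  have hK : Real.log 1152 / Real.log (1 / (t a (n + 1) / 2)) ≤
      (Real.log 1152 + 2 * Real.log 2) / Real.log (1 / (t a (n + 1) / 2)) :=
    div_le_div_of_nonneg_right (by linarith) hb0.le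
  have hq : n * Real.log 2 / Real.log (1 / (t a (n + 1) / 2)) ≤
      (n + 1 : ℕ) * Real.log 2 / ∑ i ∈ Finset.Icc 1 (n + 1), Real.log (a i) := by
    refine div_le_div₀ (by positivity) ?_ hS (by linarith)
    push_cast
    linarith
  simp only [Function.comp_apply]
  rw [Real.dist_eq, abs_le]
  constructor <;> linarith

theorem hasBoxDim_W_iff (ha : ∀ i, 1 ≤ i → 2 < a i) (L : ℝ) :
    HasBoxDim (W a σ) (1 + L) ↔ Filter.Tendsto
      (fun n : ℕ => (n : ℝ) * Real.log 2 / ∑ i ∈ Finset.Icc 1 n, Real.log (a i))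
      Filter.atTop (nhds L) := by
  rw [W_eq_shore ha]
  exact ⟨tendsto_of_hasBoxDim_shore ha, hasBoxDim_shore_of_tendsto ha⟩

theorem hasBoxDim_W_const {c : ℝ} (hc : 2 < c) (σ : ℕ → Bool) :
    HasBoxDim (W (fun _ => c) σ) (Real.log (2 * c) / Real.log c) := by
  have hlog : 0 < Real.log c := Real.log_pos (by linarith)
  have h : Real.log (2 * c) / Real.log c = 1 + Real.log 2 / Real.log c := by
    rw [Real.log_mul (by norm_num) (by linarith)]
    field_simp
    ring
  rw [h, hasBoxDim_W_iff fun _ _ => hc]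
  refine tendsto_const_nhds.congr' ?_
  filter_upwards [Filter.eventually_gt_atTop 0] with n hn
  have hn0 : (0 : ℝ) < n := by exact_mod_cast hn
  simp only [Finset.sum_const, Nat.card_Icc, Nat.add_sub_cancel, nsmul_eq_mul]
  rw [mul_div_mul_left _ _ hn0.ne']

lemma tendsto_log_two_mul_div_log :
    Filter.Tendsto (fun c : ℝ => Real.log (2 * c) / Real.log c) Filter.atTop (nhds 1) := by
  have h : Filter.Tendsto (fun c : ℝ => Real.log 2 / Real.log c + 1) Filter.atTop
      (nhds (0 + 1)) := (Real.tendsto_log_atTop.const_div_atTop _).add_const 1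
  rw [zero_add] at h
  refine h.congr' ?_
  filter_upwards [Filter.eventually_gt_atTop 1] with c hc
  have hlog : 0 < Real.log c := Real.log_pos hc
  rw [Real.log_mul (by norm_num) (by linarith)]
  field_simp

end Dimension

end Wada

theorem mainTheorem2 :
    (∀ (a : ℕ → ℝ) (_ : ∀ i, 1 ≤ i → 2 < a i) (σ : ℕ → Bool),
      Wada.unitSquare ∩ frontier (Wada.lake a σ 2) = Wada.W a σ ∧
      Wada.unitSquare ∩ frontier (Wada.lake a σ 3) = Wada.W a σ ∧
      ∀ L : ℝ, Wada.HasBoxDim (Wada.W a σ) (1 + L) ↔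
        Filter.Tendsto
          (fun n : ℕ => (n : ℝ) * Real.log 2 / ∑ i ∈ Finset.Icc 1 n, Real.log (a i))
          Filter.atTop (nhds L)) ∧
    (∀ (c : ℝ) (_ : 2 < c) (σ : ℕ → Bool),
      Wada.HasBoxDim (Wada.W (fun _ => c) σ) (Real.log (2 * c) / Real.log c)) ∧
    Filter.Tendsto (fun c : ℝ => Real.log (2 * c) / Real.log c) Filter.atTop (nhds 1) := by
  refine ⟨fun a ha σ => ⟨?_, ?_, Wada.hasBoxDim_W_iff ha⟩,
    fun c hc σ => Wada.hasBoxDim_W_const hc σ, Wada.tendsto_log_two_mul_div_log⟩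
  · rw [Wada.W_eq_shore ha]
    exact Wada.inter_frontier_lake ha (by norm_num)
  · rw [Wada.W_eq_shore ha]
    exact Wada.inter_frontier_lake ha (by norm_num)
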